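/- Let $p$ be a prime and $n$ a positive integer with $p\nmid n$, and let $G=\langle a\rangle\rtimes\langle b\rangle$ be a semidirect product of a normal cyclic subgroup $\langle a\rangle$ of order $p$ by a cyclic subgroup $\langle b\rangle$ of order $n$, where the kernel of the conjugation action of $\langle b\rangle$ on $\langle a\rangle$ has order $k$ (so $k\mid n$). Put $A=\langle a,b^{n/k}\rangle$. Let $\zeta_m$ denote a complex primitive $m$-th root of unity. For a subgroup $H$ of $G$ let $\widehat H=\frac1{|H|}\sum_{x\in H}x\in\mathbb QG$. For $K\trianglelefteq H\le G$ let $\varepsilon(H,H)=\widehat H$ and, if $K\ne H$, $\varepsilon(H,K)=\widehat K\prod_M(1-\widehat M)$, where $M$ runs over the minimal elements of the set of normal subgroups of $H$ properly containing $K$; let $e(G,H,K)$ be the sum of the distinct $G$-conjugates of $\varepsilon(H,K)$. For each $h\mid k$ put $B_h=\mathbb QG\,e(G,A,\langle b^{hn/k}\rangle)$. For a finite Galois extension $L/E$ with cyclic Galois group generated by $\sigma$ of order $d$, and $c\in E^{\times}$, let $(L/E,c)$ denote the cyclic algebra $\bigoplus_{i=0}^{d-1}L\,u^i$ with $u^d=c$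 and $ux=\sigma(x)u$ for $x\in L$. Then: 1. There is exactly one subfield $F$ of $\mathbb Q(\zeta_p)$ with $[F:\mathbb Q]=\frac{(p-1)k}{n}$. 2. If $G$ is non-commutative (equivalently $k\neq n$), then the non-commutative simple components of $\mathbb QG$ (its minimal nonzero two-sided ideals that are not commutative) are exactly the algebras $B_h$ with $h\mid k$. 3. For every $h\mid k$, $F(\zeta_h)\subseteq\mathbb Q(\zeta_{ph})$, the extension $\mathbb Q(\zeta_{ph})/F(\zeta_h)$ is finite Galois with cyclic Galois group, and $B_h\cong(\mathbb Q(\zeta_{ph})/F(\zeta_h),\zeta_h)$ as $\mathbb Q$-algebras, for every choice of the primitive roots of unity and of the generator $\sigma$ of the Galois group. -/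

import Mathlib

open scoped IntermediateField

noncomputable section

/-! ### Crossed products and cyclic algebras -/

/-- A factor set of `Gal(L/E)` with values in the units of `L`. -/
structure FactorSet (E L : Type*) [Field E] [Field L] [Algebra E L] where
  /-- The twisting. -/
  τ : (L ≃ₐ[E] L) → (L ≃ₐ[E] L) → Lˣ
  cocycle : ∀ g h k : L ≃ₐ[E] L,
    (τ g h : L) * τ (g * h) k = g (τ h k : L) * τ g (h * k)

/-- The underlying module `⨁ L u_g`, `g ∈ Gal(L/E)`, of the crossed product `(L/E, τ)`;
`Finsupp.single g x` is the element `x u_g`. -/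
def CrossedProduct {E L : Type*} [Field E] [Field L] [Algebra E L] (_c : FactorSet E L) : Type _ :=
  (L ≃ₐ[E] L) →₀ L

namespace CrossedProduct

variable {E L : Type*} [Field E] [Field L] [Algebra E L] (c : FactorSet E L)

instance : AddCommGroup (CrossedProduct c) :=
  inferInstanceAs (AddCommGroup ((L ≃ₐ[E] L) →₀ L))

instance {K : Type*} [CommSemiring K] [Algebra K L] : Module K (CrossedProduct c) :=
  inferInstanceAs (Module K ((L ≃ₐ[E] L) →₀ L))

/-- The element `x u_g`. -/
def mono (g : L ≃ₐ[E] L) (x : L) : CrossedProduct c := Finsupp.single g x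

/-- The multiplication, determined by `(x u_g) (y u_h) = x g(y) τ(g, h) u_{gh}`. -/
instance : Mul (CrossedProduct c) :=
  ⟨fun f f' => Finsupp.sum f fun g x => Finsupp.sum f' fun h y =>
    mono c (g * h) (x * g y * c.τ g h)⟩

/-- The identity element `τ(1,1)⁻¹ u_1`. -/
instance : One (CrossedProduct c) := ⟨mono c 1 ((c.τ 1 1)⁻¹ : Lˣ)⟩

theorem mono_zero (g : L ≃ₐ[E] L) : mono c g 0 = 0 := Finsupp.single_zero g

theorem mono_add (g : L ≃ₐ[E] L) (x y : L) : mono c g (x + y) = mono c g x + mono c g y :=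
  Finsupp.single_add g x y

theorem one_def : (1 : CrossedProduct c) = mono c 1 ((c.τ 1 1)⁻¹ : Lˣ) := rfl

theorem mul_def (f f' : CrossedProduct c) : f * f' =
    Finsupp.sum f fun g x => Finsupp.sum f' fun h y => mono c (g * h) (x * g y * c.τ g h) := rfl

theorem sum_mono {P : Type*} [AddCommMonoid P] (g : L ≃ₐ[E] L) (x : L)
    (F : (L ≃ₐ[E] L) → L → P) (hF : F g 0 = 0) : Finsupp.sum (mono c g x) F = F g x :=
  Finsupp.sum_single_index hF

theorem mono_mul_mono (g h : L ≃ₐ[E] L) (x y : L) :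
    mono c g x * mono c h y = mono c (g * h) (x * g y * c.τ g h) := by
  rw [mul_def, sum_mono, sum_mono]
  · simp [mono_zero]
  · rw [sum_mono] <;> simp [mono_zero]

variable {c} in
theorem induction {P : CrossedProduct c → Prop} (f : CrossedProduct c) (h0 : P 0)
    (hadd : ∀ f g, P f → P g → P (f + g)) (hmono : ∀ g x, P (mono c g x)) : P f :=
  Finsupp.induction_linear (motive := P) f h0 hadd hmono

protected theorem zero_mul (f : CrossedProduct c) : 0 * f = 0 := Finsupp.sum_zero_index

protected theorem mul_zero (f : CrossedProduct c) : f * 0 = 0 := by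
  rw [mul_def]
  exact Finset.sum_eq_zero fun _ _ => Finsupp.sum_zero_index

protected theorem add_mul (f f' g : CrossedProduct c) : (f + f') * g = f * g + f' * g := by
  simp only [mul_def]
  refine Finsupp.sum_add_index' (fun a => ?_) (fun a x y => ?_)
  · exact Finset.sum_eq_zero fun _ _ => by simp [mono_zero]
  · simp only [add_mul, mono_add]
    exact Finsupp.sum_add

protected theorem mul_add (f g g' : CrossedProduct c) : f * (g + g') = f * g + f * g' := by
  simp only [mul_def]
  refine Eq.trans (Finsupp.sum_congr fun a _ => ?_) Finsupp.sum_add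
  refine Finsupp.sum_add_index' (fun b => ?_) (fun b x y => ?_)
  · simp [mono_zero]
  · rw [map_add, mul_add, add_mul, mono_add]

protected theorem mul_assoc (f g h : CrossedProduct c) : f * g * h = f * (g * h) := by
  induction f using induction with
  | h0 => simp only [CrossedProduct.zero_mul]
  | hadd a b ha hb => simp only [CrossedProduct.add_mul, ha, hb]
  | hmono s x =>
  induction g using induction with
  | h0 => simp only [CrossedProduct.zero_mul, CrossedProduct.mul_zero]
  | hadd a b ha hb => simp only [CrossedProduct.add_mul, CrossedProduct.mul_add, ha, hb]
  | hmono t y =>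
  induction h using induction with
  | h0 => simp only [CrossedProduct.mul_zero]
  | hadd a b ha hb => simp only [CrossedProduct.mul_add, ha, hb]
  | hmono u z =>
  rw [mono_mul_mono, mono_mul_mono, mono_mul_mono, mono_mul_mono, mul_assoc s t u]
  congr 1
  rw [map_mul, map_mul, AlgEquiv.mul_apply]
  linear_combination x * s y * s (t z) * c.cocycle s t u

protected theorem one_mul (f : CrossedProduct c) : 1 * f = f := by
  induction f using induction with
  | h0 => simp only [CrossedProduct.mul_zero]
  | hadd a b ha hb => simp only [CrossedProduct.mul_add, ha, hb]
  | hmono t y =>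
  have h : (c.τ 1 1 : L) = c.τ 1 t := by
    have := c.cocycle 1 1 t
    simp only [one_mul, AlgEquiv.one_apply] at this
    exact mul_right_cancel₀ (Units.ne_zero _) this
  rw [one_def, mono_mul_mono, ← h, one_mul, AlgEquiv.one_apply, mul_right_comm, Units.inv_mul,
    one_mul]

protected theorem mul_one (f : CrossedProduct c) : f * 1 = f := by
  induction f using induction with
  | h0 => simp only [CrossedProduct.zero_mul]
  | hadd a b ha hb => simp only [CrossedProduct.add_mul, ha, hb]
  | hmono t y =>
  have h : (c.τ t 1 : L) = t (c.τ 1 1 : L) := by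
    have := c.cocycle t 1 1
    simp only [mul_one] at this
    exact mul_right_cancel₀ (Units.ne_zero _) this
  rw [one_def, mono_mul_mono, h, mul_assoc, ← map_mul, Units.inv_mul, map_one, mul_one, mul_one]

instance : Ring (CrossedProduct c) :=
  { (inferInstance : AddCommGroup (CrossedProduct c)) with
    mul := (· * ·)
    one := 1
    left_distrib := CrossedProduct.mul_add c
    right_distrib := CrossedProduct.add_mul c
    zero_mul := CrossedProduct.zero_mul c
    mul_zero := CrossedProduct.mul_zero c
    mul_assoc := CrossedProduct.mul_assoc c
    one_mul := CrossedProduct.one_mul c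
    mul_one := CrossedProduct.mul_one c }

theorem smul_mono {K : Type*} [CommSemiring K] [Algebra K L] (r : K) (g : L ≃ₐ[E] L) (x : L) :
    r • mono c g x = mono c g (r • x) := Finsupp.smul_single r g x

/-- The algebra structure over `E`, and over every `K` that maps to `E`. -/
instance {K : Type*} [CommSemiring K] [Algebra K E] [Algebra K L] [IsScalarTower K E L] :
    Algebra K (CrossedProduct c) :=
  Algebra.ofModule
    (fun r f g => by
      induction f using induction with
      | h0 => simp only [smul_zero, zero_mul]
      | hadd a b ha hb => simp only [smul_add, add_mul, ha, hb]
      | hmono s x =>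
      induction g using induction with
      | h0 => simp only [smul_zero, mul_zero]
      | hadd a b ha hb => simp only [smul_add, mul_add, ha, hb]
      | hmono t y =>
      simp only [mono_mul_mono, smul_mono, smul_mul_assoc])
    (fun r f g => by
      induction f using induction with
      | h0 => simp only [smul_zero, zero_mul]
      | hadd a b ha hb => simp only [smul_add, add_mul, ha, hb]
      | hmono s x =>
      induction g using induction with
      | h0 => simp only [smul_zero, mul_zero]
      | hadd a b ha hb => simp only [smul_add, mul_add, ha, hb]
      | hmono t y =>
      have : s (r • y) = r • s y := by
        rw [← IsScalarTower.algebraMap_smul E r y, map_smul, IsScalarTower.algebraMap_smul]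
      simp only [mono_mul_mono, smul_mono, this, mul_smul_comm, smul_mul_assoc])

end CrossedProduct

/-- The least natural number `i` with `σ ^ i = g`. -/
def powIndex {Γ : Type*} [Group Γ] (σ g : Γ) : ℕ := sInf {i : ℕ | σ ^ i = g}

theorem pow_powIndex {Γ : Type*} [Group Γ] [Finite Γ] {σ : Γ}
    (hσ : ∀ g, g ∈ Subgroup.zpowers σ) (g : Γ) : σ ^ powIndex σ g = g := by
  have : {i : ℕ | σ ^ i = g}.Nonempty := mem_powers_iff_mem_zpowers.2 (hσ g)
  exact Nat.sInf_mem this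

theorem powIndex_lt {Γ : Type*} [Group Γ] [Finite Γ] {σ : Γ}
    (hσ : ∀ g, g ∈ Subgroup.zpowers σ) (g : Γ) : powIndex σ g < orderOf σ := by
  have h : powIndex σ g % orderOf σ ∈ {i : ℕ | σ ^ i = g} := by
    rw [Set.mem_ofPred_eq, pow_mod_orderOf, pow_powIndex hσ]
  exact lt_of_le_of_lt (Nat.sInf_le h) (Nat.mod_lt _ (orderOf_pos σ))

theorem powIndex_mul {Γ : Type*} [Group Γ] [Finite Γ] {σ : Γ}
    (hσ : ∀ g, g ∈ Subgroup.zpowers σ) (g h : Γ) :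
    powIndex σ (g * h) = if powIndex σ g + powIndex σ h < orderOf σ
      then powIndex σ g + powIndex σ h else powIndex σ g + powIndex σ h - orderOf σ := by
  have hg := powIndex_lt hσ g
  have hh := powIndex_lt hσ h
  refine pow_injOn_Iio_orderOf (x := σ) (powIndex_lt hσ (g * h)) ?_ ?_
  · rw [Set.mem_Iio]
    split_ifs <;> omega
  · dsimp only
    rw [pow_powIndex hσ]
    split_ifs with hlt
    · rw [pow_add, pow_powIndex hσ, pow_powIndex hσ]
    · have : σ ^ (powIndex σ g + powIndex σ h - orderOf σ) * σ ^ orderOf σ = g * h := by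
        rw [← pow_add, Nat.sub_add_cancel (not_lt.1 hlt), pow_add, pow_powIndex hσ,
          pow_powIndex hσ]
      rw [← this, pow_orderOf_eq_one, mul_one]

/-- If `σ` is a generator of `Gal(L/E)`, of order `n`, and `a` is a unit of `E`: the factor set
with `τ(σ^i, σ^j) = 1` if `i + j < n` and `τ(σ^i, σ^j) = a` if `i + j ≥ n` (`0 ≤ i, j < n`), so
that, for `n ≥ 2`, `u_{σ^i} = u_σ^i` for `0 ≤ i < n` and `u_σ^n = a`.
For `n = 1` the factor set is trivial and the crossed product is `L = E`. -/
def FactorSet.cyclic {E L : Type*} [Field E] [Field L] [Algebra E L] [FiniteDimensional E L]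
    (σ : L ≃ₐ[E] L) (hσ : ∀ g, g ∈ Subgroup.zpowers σ) (a : Eˣ) : FactorSet E L where
  τ g h := if powIndex σ g + powIndex σ h < orderOf σ then 1
    else Units.map (algebraMap E L : E →* L) a
  cocycle g h k := by
    have hg := powIndex_lt hσ g
    have hh := powIndex_lt hσ h
    have hk := powIndex_lt hσ k
    rw [powIndex_mul hσ g h, powIndex_mul hσ h k]
    split_ifs <;> first | omega | simp

/-- The cyclic algebra `(L/E, a)`, with respect to the generator `σ` of `Gal(L/E)`. -/
abbrev CyclicAlgebra {E L : Type*} [Field E] [Field L] [Algebra E L] [FiniteDimensional E L]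
    (σ : L ≃ₐ[E] L) (hσ : ∀ g, g ∈ Subgroup.zpowers σ) (a : Eˣ) : Type _ :=
  CrossedProduct (FactorSet.cyclic σ hσ a)

/-! ### Idempotents of the rational group algebra -/

/-- `Ĥ = |H|⁻¹ ∑_{h ∈ H} h`. -/
def hatElt {G : Type*} [Group G] (H : Subgroup G) : MonoidAlgebra ℚ G :=
  (Nat.card H : ℚ)⁻¹ • ∑ᶠ h : H, MonoidAlgebra.of ℚ G (h : G)

/-- `M` is minimal among the normal subgroups of `H` that contain `K` properly. -/
def IsMinimalNormalOver {G : Type*} [Group G] (H K M : Subgroup G) : Prop :=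
  Minimal (fun N : Subgroup G => N ≤ H ∧ (N.subgroupOf H).Normal ∧ K < N) M

theorem commute_hatElt {G : Type*} [Group G] [Finite G] {H M N : Subgroup G} (hN : N ≤ H)
    (hNn : (N.subgroupOf H).Normal) (hM : M ≤ H) : Commute (hatElt M) (hatElt N) := by
  have := Fintype.ofFinite N
  have := Fintype.ofFinite M
  have key : ∀ m ∈ H, Commute (MonoidAlgebra.of ℚ G m) (hatElt N) := by
    intro m hm
    refine Commute.smul_right ?_ _
    rw [finsum_eq_sum_of_fintype, commute_iff_eq, Finset.mul_sum, Finset.sum_mul]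
    have hc : ∀ x ∈ H, ∀ y ∈ N, x * y * x⁻¹ ∈ N := fun x hx y hy =>
      hNn.conj_mem ⟨y, hN hy⟩ hy ⟨x, hx⟩
    let e : N ≃ N :=
      { toFun := fun y => ⟨m * y * m⁻¹, hc m hm y y.2⟩
        invFun := fun y => ⟨m⁻¹ * y * m, by simpa using hc m⁻¹ (H.inv_mem hm) y y.2⟩
        left_inv := fun y => by ext; simp [mul_assoc]
        right_inv := fun y => by ext; simp [mul_assoc] }
    refine Fintype.sum_equiv e _ _ fun y => ?_
    rw [← map_mul, ← map_mul]
    simp [e]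
  refine Commute.smul_left ?_ _
  rw [finsum_eq_sum_of_fintype]
  exact Commute.sum_left _ _ _ fun m _ => key m (hM m.2)

open Classical in
/-- `ε(H, K)`: it is `Ĥ` if `K = H`, and `K̂ ∏ (1 - M̂)` otherwise, the product over all minimal
normal subgroups `M` of `H` containing `K` properly (its factors commute). -/
def epsElt {G : Type*} [Group G] [Finite G] (H K : Subgroup G) : MonoidAlgebra ℚ G :=
  if K = H then hatElt H else
    hatElt K * (Set.toFinite {M : Subgroup G | IsMinimalNormalOver H K M}).toFinset.noncommProd
      (fun M => 1 - hatElt M) (by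
        intro M hM N hN _
        rw [Finset.mem_coe, Set.Finite.mem_toFinset] at hM hN
        exact (Commute.one_left _).sub_left
          ((Commute.one_right _).sub_right (commute_hatElt hN.1.1 hN.1.2.1 hM.1.1)))

/-- `e(G, H, K)`: the sum of the distinct `G`-conjugates of `ε(H, K)`. -/
def eElt {G : Type*} [Group G] [Finite G] (H K : Subgroup G) : MonoidAlgebra ℚ G :=
  ∑ᶠ x ∈ Set.range (fun g : G =>
    MonoidAlgebra.of ℚ G g⁻¹ * epsElt H K * MonoidAlgebra.of ℚ G g), x

/-! ### Simple components -/

/-- The set `R e = {x e : x ∈ R}` with the operations of `R`. -/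
def componentOf {R : Type*} [Ring R] [Algebra ℚ R] (e : R) : NonUnitalSubalgebra ℚ R where
  carrier := Set.range fun x => x * e
  add_mem' := by
    rintro _ _ ⟨x, rfl⟩ ⟨y, rfl⟩
    exact ⟨x + y, add_mul x y e⟩
  zero_mem' := ⟨0, zero_mul e⟩
  mul_mem' := by
    rintro _ _ ⟨x, rfl⟩ ⟨y, rfl⟩
    exact ⟨x * e * y, by simp only [mul_assoc]⟩
  smul_mem' := by
    rintro r _ ⟨x, rfl⟩
    exact ⟨r • x, smul_mul_assoc r x e⟩

/-- `B` is a simple component of the semisimple algebra `R`: a minimal nonzero two-sided ideal. -/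
def IsSimpleComponent {R : Type*} [Ring R] [Algebra ℚ R] (B : NonUnitalSubalgebra ℚ R) : Prop :=
  ∃ I : TwoSidedIdeal R, IsAtom I ∧ (B : Set R) = {x | x ∈ I}

/-- The algebra `B_h = ℚG e(G, A, ⟨b^{hn/k}⟩)`, where `A = ⟨a, b^{n/k}⟩`. -/
def compB {G : Type*} [Group G] [Finite G] (a b : G) (n k h : ℕ) :
    NonUnitalSubalgebra ℚ (MonoidAlgebra ℚ G) :=
  componentOf (eElt (Subgroup.closure {a, b ^ (n / k)}) (Subgroup.zpowers (b ^ (h * (n / k)))))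

end

/-!
Let `d = n / k` be the order of the automorphism `x ↦ x ^ r` which `b` induces on `⟨a⟩`. The
subgroup `A` is cyclic of order `p k`, generated by `c = a b ^ d`, and normal, and `⟨b ^ (h d)⟩` is
the subgroup of index `p h` in `⟨c⟩`. Hence `ε(A, ⟨b ^ (h d)⟩)` is the primitive idempotent of
`ℚ⟨c⟩` belonging to the characters of `⟨c⟩` of order `p h`; it is central in `ℚG`. An element killed
by all these idempotents is fixed by `Ĥ` for `H = ⟨a⟩ ≥ [G, G]`, so it is central.

Sending `a` to a primitive `p`-th root of unity and `b` to the generator `u` of the cyclic algebra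
defines a homomorphism `ℚG → (ℚ(ζ_{ph})/F(ζ_h), ζ_h)`, once `b` has been replaced by another
generator of `⟨b⟩` acting on `⟨a⟩` as `σ` does on the `p`-th roots of unity. It maps `ℚG ε`
isomorphically onto the cyclic algebra: writing an element of `ℚG` as `∑ q_i(c) b ^ i` with
`i < d`, its image is `∑ q_i(ζ_{ph}) u ^ i`, and this vanishes iff the cyclotomic polynomial
`Φ_{ph}` divides every `q_i`.
-/

namespace FactorSet

variable {E L : Type*} [Field E] [Field L] [Algebra E L] (c : FactorSet E L)

theorem τ_one_left (t : L ≃ₐ[E] L) : (c.τ 1 t : L) = c.τ 1 1 := by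
  have := c.cocycle 1 1 t
  simp only [one_mul, AlgEquiv.one_apply] at this
  exact (mul_right_cancel₀ (Units.ne_zero _) this).symm

theorem τ_one_right (t : L ≃ₐ[E] L) : (c.τ t 1 : L) = t (c.τ 1 1 : L) := by
  have := c.cocycle t 1 1
  simp only [mul_one] at this
  exact mul_right_cancel₀ (Units.ne_zero _) this

end FactorSet

namespace CrossedProduct

variable {E L : Type*} [Field E] [Field L] [Algebra E L] {c : FactorSet E L}

/-- The coefficient of `u_g`, as an additive map. -/
noncomputable def coeff (g : L ≃ₐ[E] L) : CrossedProduct c →+ L :=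
  Finsupp.applyAddHom (M := L) g

theorem finite_setOf_coeff_ne_zero (f : CrossedProduct c) : {g | coeff g f ≠ 0}.Finite :=
  Finsupp.hasFiniteSupport (M := L) f

theorem ext_coeff {f f' : CrossedProduct c} (h : ∀ g, coeff g f = coeff g f') : f = f' :=
  Finsupp.ext (M := L) h

theorem coeff_mono_self (g : L ≃ₐ[E] L) (x : L) : coeff g (mono c g x) = x :=
  Finsupp.single_eq_same

theorem coeff_mono_of_ne {g h : L ≃ₐ[E] L} (hgh : h ≠ g) (x : L) : coeff h (mono c g x) = 0 :=
  Finsupp.single_eq_of_ne hgh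

theorem coeff_mono_mul (s h : L ≃ₐ[E] L) (x : L) (f : CrossedProduct c) :
    coeff (s * h) (mono c s x * f) = x * s (coeff h f) * c.τ s h := by
  induction f using induction with
  | h0 => simp
  | hadd f f' hf hf' =>
    rw [mul_add, map_add, hf, hf', map_add, map_add]
    ring
  | hmono t y =>
    rw [mono_mul_mono]
    obtain rfl | hne := eq_or_ne h t
    · rw [coeff_mono_self, coeff_mono_self]
    · rw [coeff_mono_of_ne hne, coeff_mono_of_ne fun h => hne (mul_left_cancel h), map_zero,
        mul_zero, zero_mul]

theorem coeff_mul_mono (g t : L ≃ₐ[E] L) (y : L) (f : CrossedProduct c) :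
    coeff (g * t) (f * mono c t y) = coeff g f * g y * c.τ g t := by
  induction f using induction with
  | h0 => simp
  | hadd f f' hf hf' =>
    rw [add_mul, map_add, hf, hf', map_add]
    ring
  | hmono s x =>
    rw [mono_mul_mono]
    obtain rfl | hne := eq_or_ne g s
    · rw [coeff_mono_self, coeff_mono_self]
    · rw [coeff_mono_of_ne hne, coeff_mono_of_ne fun h => hne (mul_right_cancel h), zero_mul,
        zero_mul]

variable (c) in
/-- The embedding of the field `L`, which sends `x` to `x τ(1,1)⁻¹ u_1 = x · 1`. -/
noncomputable def ofField : L →+* CrossedProduct c where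
  toFun x := mono c 1 (x * ((c.τ 1 1)⁻¹ : Lˣ))
  map_one' := by rw [one_mul, one_def]
  map_mul' x y := by
    rw [mono_mul_mono, mul_one, AlgEquiv.one_apply, ← mul_assoc, Units.inv_mul_cancel_right]
    ring_nf
  map_zero' := by rw [zero_mul, mono_zero]
  map_add' x y := by rw [add_mul, mono_add]

theorem ofField_apply (x : L) : ofField c x = mono c 1 (x * ((c.τ 1 1)⁻¹ : Lˣ)) := rfl

theorem ofField_mul_mono (x y : L) (g : L ≃ₐ[E] L) :
    ofField c x * mono c g y = mono c g (x * y) := by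
  rw [ofField_apply, mono_mul_mono, one_mul, c.τ_one_left, AlgEquiv.one_apply, mul_right_comm,
    Units.inv_mul_cancel_right]

theorem mono_mul_ofField (x y : L) (g : L ≃ₐ[E] L) :
    mono c g y * ofField c x = mono c g (y * g x) := by
  rw [ofField_apply, mono_mul_mono, mul_one, c.τ_one_right, mul_assoc, ← map_mul,
    Units.inv_mul_cancel_right]

theorem coeff_ofField_mul (x : L) (f : CrossedProduct c) (g : L ≃ₐ[E] L) :
    coeff g (ofField c x * f) = x * coeff g f := by
  have := coeff_mono_mul 1 g (x * ((c.τ 1 1)⁻¹ : Lˣ)) f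
  rwa [one_mul, AlgEquiv.one_apply, c.τ_one_left, mul_right_comm,
    Units.inv_mul_cancel_right] at this

theorem coeff_mul_ofField (x : L) (f : CrossedProduct c) (g : L ≃ₐ[E] L) :
    coeff g (f * ofField c x) = coeff g f * g x := by
  have := coeff_mul_mono g 1 (x * ((c.τ 1 1)⁻¹ : Lˣ)) f
  rwa [mul_one, c.τ_one_right, mul_assoc, ← map_mul, Units.inv_mul_cancel_right] at this

theorem exists_mem_coeff_one_ne_zero {I : TwoSidedIdeal (CrossedProduct c)} (hI : I ≠ ⊥) :
    ∃ f ∈ I, coeff 1 f ≠ 0 := by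
  obtain ⟨f, hf, hf0⟩ := SetLike.exists_of_lt (bot_lt_iff_ne_bot.2 hI)
  obtain ⟨s, hs⟩ : ∃ s, coeff s f ≠ 0 := by
    by_contra! h
    exact hf0 ((TwoSidedIdeal.mem_bot _).2 (ext_coeff fun s => (h s).trans (map_zero _).symm))
  refine ⟨f * mono c s⁻¹ 1, I.mul_mem_right _ _ hf, ?_⟩
  have hc := coeff_mul_mono s s⁻¹ 1 f
  rw [mul_inv_cancel, map_one, mul_one] at hc
  exact hc ▸ mul_ne_zero hs (Units.ne_zero _)

theorem exists_mem_coeff_eq_zero {I : TwoSidedIdeal (CrossedProduct c)} {f : CrossedProduct c}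
    (hf : f ∈ I) (hf1 : coeff 1 f ≠ 0) (S : Finset (L ≃ₐ[E] L)) (hS : 1 ∉ S) :
    ∃ f' ∈ I, coeff 1 f' ≠ 0 ∧ ∀ g, coeff g f = 0 ∨ g ∈ S → coeff g f' = 0 := by
  classical
  induction S using Finset.induction_on with
  | empty => exact ⟨f, hf, hf1, by simp⟩
  | insert s S _ ih =>
    rw [Finset.mem_insert, not_or] at hS
    obtain ⟨f', hf', hf'1, hf'0⟩ := ih hS.2
    obtain ⟨x, hx⟩ : ∃ x, s x ≠ x := by
      by_contra! h
      exact hS.1 (AlgEquiv.ext h).symm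
    have hcoeff (g : L ≃ₐ[E] L) : coeff g (ofField c (s x) * f' - f' * ofField c x) =
        (s x - g x) * coeff g f' := by
      rw [map_sub, coeff_ofField_mul, coeff_mul_ofField]
      ring
    refine ⟨ofField c (s x) * f' - f' * ofField c x,
      I.sub_mem (I.mul_mem_left _ _ hf') (I.mul_mem_right _ _ hf'), ?_, fun g hg => ?_⟩
    · rw [hcoeff]
      exact mul_ne_zero (sub_ne_zero.2 hx) hf'1
    · rw [hcoeff, mul_eq_zero]
      obtain rfl | hgs := eq_or_ne g s
      · exact .inl (sub_self _)
      · exact .inr (hf'0 g (hg.imp_right fun h => Finset.mem_of_mem_insert_of_ne h hgs))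

theorem exists_mul_ne_mul {g : L ≃ₐ[E] L} (hg : g ≠ 1) :
    ∃ f f' : CrossedProduct c, f * f' ≠ f' * f := by
  obtain ⟨x, hx⟩ : ∃ x, g x ≠ x := by
    by_contra! h
    exact hg (AlgEquiv.ext h)
  refine ⟨mono c g 1, ofField c x, fun h => hx ?_⟩
  simpa only [coeff_ofField_mul, coeff_mul_ofField, coeff_mono_self, one_mul, mul_one]
    using congrArg (coeff g) h

instance : Nontrivial (CrossedProduct c) := by
  refine ⟨1, 0, fun h => ?_⟩
  have h1 := congrArg (coeff 1) h
  rw [one_def, coeff_mono_self, map_zero] at h1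
  exact Units.ne_zero _ h1

instance : IsSimpleRing (CrossedProduct c) := by
  classical
  refine .of_eq_bot_or_eq_top fun I => or_iff_not_imp_left.2 fun hI => ?_
  obtain ⟨f, hf, hf1⟩ := exists_mem_coeff_one_ne_zero hI
  obtain ⟨f', hf', hf'1, hf'0⟩ := exists_mem_coeff_eq_zero hf hf1
    ((finite_setOf_coeff_ne_zero f).toFinset.erase 1) (Finset.notMem_erase _ _)
  have hone : ofField c ((coeff 1 f')⁻¹ * ((c.τ 1 1)⁻¹ : Lˣ)) * f' = 1 := by
    refine ext_coeff fun g => ?_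
    rw [coeff_ofField_mul, one_def]
    obtain rfl | hg := eq_or_ne g 1
    · rw [coeff_mono_self, mul_right_comm, inv_mul_cancel₀ hf'1, one_mul]
    · have hf'g : coeff g f' = 0 := hf'0 g <| or_iff_not_imp_left.2 fun hgf =>
        Finset.mem_erase.2 ⟨hg, (Set.Finite.mem_toFinset _).2 hgf⟩
      rw [coeff_mono_of_ne hg, hf'g, mul_zero]
  exact I.one_mem_iff.1 (hone ▸ I.mul_mem_left _ _ hf')

end CrossedProduct

theorem powIndex_pow {Γ : Type*} [Group Γ] [Finite Γ] {σ : Γ}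
    (hσ : ∀ g, g ∈ Subgroup.zpowers σ) {i : ℕ} (hi : i < orderOf σ) : powIndex σ (σ ^ i) = i :=
  pow_injOn_Iio_orderOf (powIndex_lt hσ _) hi (pow_powIndex hσ _)

namespace CyclicAlgebra

open CrossedProduct

variable {E L : Type*} [Field E] [Field L] [Algebra E L] [FiniteDimensional E L]
  {σ : L ≃ₐ[E] L} (hσ : ∀ g, g ∈ Subgroup.zpowers σ) (a : Eˣ)

theorem τ_pow_pow {i j : ℕ} (hi : i < orderOf σ) (hj : j < orderOf σ) :
    (FactorSet.cyclic σ hσ a).τ (σ ^ i) (σ ^ j) = if i + j < orderOf σ then 1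
      else Units.map (algebraMap E L : E →* L) a := by
  simp only [FactorSet.cyclic, powIndex_pow hσ hi, powIndex_pow hσ hj]

theorem τ_one_one : (FactorSet.cyclic σ hσ a).τ 1 1 = 1 := by
  have hpos := orderOf_pos σ
  simpa only [pow_zero, add_zero, if_pos hpos] using τ_pow_pow hσ a hpos hpos

theorem ofField_apply (x : L) :
    ofField (FactorSet.cyclic σ hσ a) x = mono (FactorSet.cyclic σ hσ a) 1 x := by
  rw [CrossedProduct.ofField_apply, τ_one_one, inv_one, Units.val_one, mul_one]

open Classical in
/-- The standard generator `u` of the cyclic algebra `(L/E, a)` over `L`, with `u x = σ(x) u` for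
`x` in `L` and `u ^ n = a`, where `n` is the order of `σ`. It is `u_σ` except for `n = 1`, when
`u_σ = 1` and `a` itself has to be taken. -/
noncomputable def gen : CyclicAlgebra σ hσ a :=
  if orderOf σ = 1 then mono _ 1 (algebraMap E L a) else mono _ σ 1

variable {hσ a}

theorem gen_mul_ofField (x : L) : gen hσ a * ofField _ x = ofField _ (σ x) * gen hσ a := by
  rw [gen]
  split_ifs with h
  · have hx : σ x = x := by rw [orderOf_eq_one_iff.1 h, AlgEquiv.one_apply]
    rw [mono_mul_ofField, ofField_mul_mono, hx, AlgEquiv.one_apply, mul_comm]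
  · rw [mono_mul_ofField, ofField_mul_mono, mul_comm]

theorem gen_pow {i : ℕ} (hi : i < orderOf σ) : gen hσ a ^ i = mono _ (σ ^ i) 1 := by
  induction i with
  | zero => rw [pow_zero, pow_zero, one_def, τ_one_one, inv_one, Units.val_one]
  | succ i ih =>
    have h1 : 1 < orderOf σ := by omega
    have hτ := τ_pow_pow hσ a (i.lt_succ_self.trans hi) h1
    rw [pow_one, if_pos hi] at hτ
    rw [pow_succ, ih (i.lt_succ_self.trans hi), gen, if_neg h1.ne', mono_mul_mono, hτ, pow_succ,
      map_one, mul_one, Units.val_one, mul_one]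

theorem gen_pow_orderOf : gen hσ a ^ orderOf σ = ofField _ (algebraMap E L a) := by
  rw [ofField_apply]
  obtain ⟨n, hn⟩ : ∃ n, orderOf σ = n + 1 := Nat.exists_eq_succ_of_ne_zero (orderOf_pos σ).ne'
  obtain rfl | hn0 := Nat.eq_zero_or_pos n
  · rw [hn, zero_add, pow_one, gen, if_pos hn]
  · have h1 : 1 < orderOf σ := by omega
    have hτ := τ_pow_pow hσ a (show n < orderOf σ by omega) h1
    rw [pow_one, if_neg (by omega)] at hτ
    rw [hn, pow_succ, gen_pow (by omega), gen, if_neg h1.ne', mono_mul_mono, hτ, ← pow_succ, ← hn,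
      pow_orderOf_eq_one, map_one, mul_one, one_mul, Units.coe_map, MonoidHom.coe_coe]

theorem ofField_mul_gen_pow (x : L) {i : ℕ} (hi : i < orderOf σ) :
    ofField _ x * gen hσ a ^ i = mono _ (σ ^ i) x := by
  rw [gen_pow hi, ofField_mul_mono, mul_one]

theorem exists_eq_sum (f : CyclicAlgebra σ hσ a) :
    ∃ x : ℕ → L, f = ∑ i ∈ Finset.range (orderOf σ), ofField _ (x i) * gen hσ a ^ i := by
  induction f using CrossedProduct.induction with
  | h0 => exact ⟨0, by simp⟩
  | hadd f g hf hg =>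
    obtain ⟨x, rfl⟩ := hf
    obtain ⟨y, rfl⟩ := hg
    exact ⟨x + y, by simp [add_mul, Finset.sum_add_distrib]⟩
  | hmono g x =>
    refine ⟨Pi.single (powIndex σ g) x, ?_⟩
    have hg := powIndex_lt hσ g
    rw [Finset.sum_eq_single_of_mem _ (Finset.mem_range.2 hg)]
    · rw [Pi.single_eq_same, ofField_mul_gen_pow _ hg, pow_powIndex hσ]
    · intro i _ hi
      rw [Pi.single_eq_of_ne hi, map_zero, zero_mul]

theorem coeff_pow_sum (x : ℕ → L) {j : ℕ} (hj : j < orderOf σ) :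
    coeff (σ ^ j) (∑ i ∈ Finset.range (orderOf σ),
      ofField (FactorSet.cyclic σ hσ a) (x i) * gen hσ a ^ i) = x j := by
  rw [map_sum, Finset.sum_eq_single_of_mem _ (Finset.mem_range.2 hj)]
  · rw [ofField_mul_gen_pow _ hj, coeff_mono_self]
  · intro i hi hij
    rw [ofField_mul_gen_pow _ (Finset.mem_range.1 hi), coeff_mono_of_ne]
    exact fun h => hij (pow_injOn_Iio_orderOf (Finset.mem_range.1 hi) hj h.symm)

end CyclicAlgebra

section HatElt

open MonoidAlgebra
open scoped commutatorElement

variable {G : Type*} [Group G] {H K N : Subgroup G} {x : MonoidAlgebra ℚ G}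

theorem of_mul_hatElt [Finite H] {m : G} (hm : m ∈ H) : of ℚ G m * hatElt H = hatElt H := by
  have := Fintype.ofFinite H
  rw [hatElt, finsum_eq_sum_of_fintype, mul_smul_comm, Finset.mul_sum]
  congr 1
  refine Fintype.sum_equiv (Equiv.mulLeft ⟨m, hm⟩) _ _ fun h => ?_
  rw [← map_mul]
  rfl

theorem hatElt_mul_of [Finite H] {m : G} (hm : m ∈ H) : hatElt H * of ℚ G m = hatElt H := by
  have := Fintype.ofFinite H
  rw [hatElt, finsum_eq_sum_of_fintype, smul_mul_assoc, Finset.sum_mul]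
  congr 1
  refine Fintype.sum_equiv (Equiv.mulRight ⟨m, hm⟩) _ _ fun h => ?_
  rw [← map_mul]
  rfl

theorem map_hatElt_mul [Finite H] {V : Type*} [Ring V] [Algebra ℚ V]
    (ψ : MonoidAlgebra ℚ G →ₐ[ℚ] V) {v : V} (h : ∀ m ∈ H, ψ (of ℚ G m) * v = v) :
    ψ (hatElt H) * v = v := by
  have := Fintype.ofFinite H
  rw [hatElt, finsum_eq_sum_of_fintype, map_smul, map_sum, smul_mul_assoc, Finset.sum_mul,
    Finset.sum_congr rfl fun (m : H) _ => h m m.2, Finset.sum_const, Finset.card_univ,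
    ← Nat.card_eq_fintype_card, ← Nat.cast_smul_eq_nsmul ℚ, smul_smul, inv_mul_cancel₀, one_smul]
  exact Nat.cast_ne_zero.2 Nat.card_pos.ne'

theorem map_hatElt_eq_one [Finite H] {V : Type*} [Ring V] [Algebra ℚ V]
    (ψ : MonoidAlgebra ℚ G →ₐ[ℚ] V) (h : ∀ m ∈ H, ψ (of ℚ G m) = 1) : ψ (hatElt H) = 1 := by
  simpa only [mul_one] using map_hatElt_mul ψ (v := 1) fun m hm => by rw [h m hm, mul_one]

theorem map_hatElt_eq_zero [Finite H] {V : Type*} [Ring V] [Algebra ℚ V]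
    (ψ : MonoidAlgebra ℚ G →ₐ[ℚ] V) {m : G} (hm : m ∈ H) (h : IsUnit (ψ (of ℚ G m) - 1)) :
    ψ (hatElt H) = 0 := by
  refine h.mul_right_eq_zero.1 ?_
  rw [sub_mul, one_mul, ← map_mul, of_mul_hatElt hm, sub_self]

theorem hatElt_mul_of_forall [Finite H] (h : ∀ m ∈ H, of ℚ G m * x = x) : hatElt H * x = x :=
  map_hatElt_mul (AlgHom.id ℚ (MonoidAlgebra ℚ G)) h

theorem hatElt_mul_hatElt_of_le [Finite K] [Finite H] (h : K ≤ H) :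
    hatElt K * hatElt H = hatElt H :=
  hatElt_mul_of_forall fun _ hm => of_mul_hatElt (h hm)

theorem hatElt_zpowers_mul {s : G} [Finite (Subgroup.zpowers s)] (h : of ℚ G s * x = x) :
    hatElt (Subgroup.zpowers s) * x = x := by
  have hs : IsOfFinOrder s := finite_zpowers.1 ‹_›
  refine hatElt_mul_of_forall fun m hm => ?_
  obtain ⟨i, rfl⟩ := hs.mem_powers_iff_mem_zpowers.2 hm
  induction i with
  | zero => simp only [pow_zero, map_one, one_mul]
  | succ i ih => simp only [pow_succ, map_mul, mul_assoc, h] at ih ⊢; exact ih ⟨i, by simp⟩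

theorem mem_center_of_forall_of (h : ∀ g, of ℚ G g * x = x * of ℚ G g) :
    x ∈ Subalgebra.center ℚ (MonoidAlgebra ℚ G) := by
  refine Subalgebra.mem_center_iff.2 fun y => ?_
  induction y using MonoidAlgebra.induction_on with
  | of g => exact h g
  | add y z hy hz => rw [add_mul, mul_add, hy, hz]
  | smul r y hy => rw [smul_mul_assoc, mul_smul_comm, hy]

theorem hatElt_mem_center [Finite N] [N.Normal] :
    hatElt N ∈ Subalgebra.center ℚ (MonoidAlgebra ℚ G) := by
  have := Fintype.ofFinite N
  refine mem_center_of_forall_of fun g => ?_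
  rw [hatElt, finsum_eq_sum_of_fintype, mul_smul_comm, smul_mul_assoc, Finset.mul_sum,
    Finset.sum_mul]
  congr 1
  refine Fintype.sum_equiv (MulAut.conjNormal g).toEquiv _ _ fun m => ?_
  simp only [MulEquiv.toEquiv_eq_coe, EquivLike.coe_coe, MulAut.conjNormal_apply, ← map_mul,
    inv_mul_cancel_right]

theorem mem_center_of_mul_hatElt_eq_self [Finite N] [N.Normal] (hN : commutator G ≤ N)
    (hx : x * hatElt N = x) : x ∈ Subalgebra.center ℚ (MonoidAlgebra ℚ G) := by
  have hcomm (g : G) (y : MonoidAlgebra ℚ G) :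
      of ℚ G g * y * hatElt N = y * of ℚ G g * hatElt N := by
    induction y using MonoidAlgebra.induction_on with
    | of h =>
      have hmem : ⁅g⁻¹, h⁻¹⁆ ∈ N :=
        hN (Subgroup.commutator_mem_commutator (Subgroup.mem_top _) (Subgroup.mem_top _))
      have hgh : g * h = h * g * ⁅g⁻¹, h⁻¹⁆ := by rw [commutatorElement_def]; group
      rw [← map_mul, hgh, map_mul, mul_assoc, of_mul_hatElt hmem, map_mul]
    | add y z hy hz => simp only [mul_add, add_mul, hy, hz]
    | smul r y hy => simp only [mul_smul_comm, smul_mul_assoc, hy]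
  refine mem_center_of_forall_of fun g => ?_
  calc of ℚ G g * x = of ℚ G g * x * hatElt N := by rw [mul_assoc, hx]
    _ = x * of ℚ G g * hatElt N := hcomm g x
    _ = x * of ℚ G g := by
      rw [mul_assoc, Subalgebra.mem_center_iff.1 hatElt_mem_center, ← mul_assoc, hx]

end HatElt

section EpsElt

open MonoidAlgebra

variable {G : Type*} [Group G] {H K : Subgroup G} {x : MonoidAlgebra ℚ G}

theorem IsMinimalNormalOver.ne {M : Subgroup G} (h : IsMinimalNormalOver H K M) : K ≠ H :=
  (h.1.2.2.trans_le h.1.1).ne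

variable [Finite G]

theorem exists_epsElt_eq (H K : Subgroup G) :
    ∃ S : Finset (Subgroup G), (∀ M, M ∈ S ↔ IsMinimalNormalOver H K M) ∧ ∃ comm,
    epsElt H K = hatElt K * S.noncommProd (fun M => 1 - hatElt M) comm := by
  by_cases h : K = H
  · refine ⟨∅, fun M => ?_, by simp, ?_⟩
    · simpa only [Finset.notMem_empty, false_iff] using fun hM => hM.ne h
    · rw [Finset.noncommProd_empty, mul_one, epsElt, if_pos h, h]
  · exact ⟨_, fun _ => (Set.toFinite {M | IsMinimalNormalOver H K M}).mem_toFinset, _, if_neg h⟩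

theorem mul_epsElt_of_forall
    (h : ∀ M, IsMinimalNormalOver H K M → x * hatElt K * hatElt M = 0) :
    x * epsElt H K = x * hatElt K := by
  obtain ⟨S, hS, comm, he⟩ := exists_epsElt_eq H K
  rw [he, ← mul_assoc]
  refine Finset.noncommProd_induction _ _ comm (fun z => x * hatElt K * z = x * hatElt K)
    (fun z w hz hw => ?_) (mul_one _) (fun M hM => ?_)
  · rw [← mul_assoc, hz, hw]
  · rw [mul_sub, mul_one, h M ((hS M).1 hM), sub_zero]

theorem hatElt_mul_epsElt : hatElt K * epsElt H K = epsElt H K := by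
  obtain ⟨S, -, comm, he⟩ := exists_epsElt_eq H K
  rw [he, ← mul_assoc, hatElt_mul_hatElt_of_le le_rfl]

theorem hatElt_mul_epsElt_of_isMinimalNormalOver {M : Subgroup G}
    (hM : IsMinimalNormalOver H K M) : hatElt M * epsElt H K = 0 := by
  classical
  obtain ⟨S, hS, comm, he⟩ := exists_epsElt_eq H K
  have hKM : hatElt K * hatElt M = hatElt M * hatElt K :=
    commute_hatElt hM.1.1 hM.1.2.1 (hM.1.2.2.le.trans hM.1.1)
  rw [he, ← Finset.mul_noncommProd_erase _ ((hS M).2 hM), ← mul_assoc, ← mul_assoc, ← hKM,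
    mul_assoc (hatElt K), mul_sub, mul_one, hatElt_mul_hatElt_of_le le_rfl, sub_self, mul_zero,
    zero_mul]

theorem map_epsElt {V : Type*} [Ring V] [Algebra ℚ V] (ψ : MonoidAlgebra ℚ G →ₐ[ℚ] V)
    (hK : ψ (hatElt K) = 1) (hM : ∀ M, IsMinimalNormalOver H K M → ψ (hatElt M) = 0) :
    ψ (epsElt H K) = 1 := by
  obtain ⟨S, hS, comm, he⟩ := exists_epsElt_eq H K
  rw [he, map_mul, hK, one_mul]
  refine Finset.noncommProd_induction _ _ comm (fun z => ψ z = 1)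
    (fun z w hz hw => ?_) (map_one _) (fun M hM' => ?_)
  · rw [map_mul, hz, hw, one_mul]
  · rw [map_sub, map_one, hM M ((hS M).1 hM'), sub_zero]

theorem epsElt_mem_center (hK : K.Normal) (hM : ∀ M, IsMinimalNormalOver H K M → M.Normal) :
    epsElt H K ∈ Subalgebra.center ℚ (MonoidAlgebra ℚ G) := by
  obtain ⟨S, hS, comm, he⟩ := exists_epsElt_eq H K
  rw [he]
  refine mul_mem hatElt_mem_center (Submonoid.noncommProd_mem
    (Subalgebra.center ℚ (MonoidAlgebra ℚ G)).toSubmonoid _ _ _ fun M hM' => ?_)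
  have := hM M ((hS M).1 hM')
  exact Subalgebra.sub_mem _ (one_mem _) hatElt_mem_center

theorem eElt_eq_epsElt (h : epsElt H K ∈ Subalgebra.center ℚ (MonoidAlgebra ℚ G)) :
    eElt H K = epsElt H K := by
  have hconj (g : G) : of ℚ G g⁻¹ * epsElt H K * of ℚ G g = epsElt H K := by
    rw [Subalgebra.mem_center_iff.1 h, mul_assoc, ← map_mul, inv_mul_cancel, map_one, mul_one]
  rw [eElt, funext hconj, Set.range_const, finsum_mem_singleton]

end EpsElt

section Cyclotomic

open Polynomial

variable {F A : Type*} [Field F] [Ring A] [Algebra F A]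

theorem exists_prime_isCoprime_cyclotomic_geom_sum {m N : ℕ} (hN : (N : F) ≠ 0)
    (hm : m ∈ N.properDivisors) : ∃ q, q.Prime ∧ q ∣ N ∧
      IsCoprime (cyclotomic m F) (∑ j ∈ Finset.range q, (X ^ (N / q)) ^ j) := by
  obtain ⟨hmN, hlt⟩ := Nat.mem_properDivisors.1 hm
  obtain ⟨c, rfl⟩ := hmN
  obtain ⟨q, hq, hqc⟩ := Nat.exists_prime_and_dvd (n := c) (by rintro rfl; simp at hlt)
  have hqN : q ∣ m * c := hqc.mul_left m
  have hdvd : cyclotomic m F ∣ X ^ (m * c / q) - 1 :=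
    (cyclotomic.dvd_X_pow_sub_one m F).trans
      (dvd_pow_sub_one_of_dvd (by rw [Nat.mul_div_assoc m hqc]; exact dvd_mul_right _ _))
  refine ⟨q, hq, hqN, IsCoprime.of_isCoprime_of_dvd_left (Separable.isCoprime ?_) hdvd⟩
  rw [mul_geom_sum, ← pow_mul, Nat.div_mul_cancel hqN]
  exact X_pow_sub_one_separable_iff.2 hN

theorem eq_zero_of_isCoprime_of_aeval_mul_eq_zero {f g : F[X]} (hfg : IsCoprime f g) {x w : A}
    (hf : aeval x f * w = 0) (hg : aeval x g * w = 0) : w = 0 := by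
  obtain ⟨r, s, hrs⟩ := hfg
  calc w = aeval x (r * f + s * g) * w := by rw [hrs, map_one, one_mul]
    _ = 0 := by rw [map_add, map_mul, map_mul, add_mul, mul_assoc, mul_assoc, hf, hg, mul_zero,
      mul_zero, add_zero]

theorem aeval_cyclotomic_mul_eq_zero {N : ℕ} (hN : (N : F) ≠ 0) {x e : A} (hx : x ^ N * e = e)
    (hq : ∀ q, q.Prime → q ∣ N → (∑ j ∈ Finset.range q, (x ^ (N / q)) ^ j) * e = 0) :
    aeval x (cyclotomic N F) * e = 0 := by
  have hN0 : N ≠ 0 := by rintro rfl; simp at hN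
  have hprod : aeval x ((∏ m ∈ N.properDivisors, cyclotomic m F) * cyclotomic N F) * e = 0 := by
    rw [mul_comm, ← Finset.prod_insert (f := (cyclotomic · F)) Nat.self_notMem_properDivisors,
      Nat.insert_self_properDivisors hN0, prod_cyclotomic_eq_X_pow_sub_one hN0.bot_lt, map_sub,
      map_pow, aeval_X, map_one, sub_mul, one_mul, hx, sub_self]
  suffices h : ∀ S ⊆ N.properDivisors,
      aeval x ((∏ m ∈ S, cyclotomic m F) * cyclotomic N F) * e = 0 →
        aeval x (cyclotomic N F) * e = 0 from h _ subset_rfl hprod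
  intro S hS hSe
  induction S using Finset.induction_on with
  | empty => simpa only [Finset.prod_empty, one_mul] using hSe
  | insert m S hmS ih =>
    rw [Finset.insert_subset_iff] at hS
    obtain ⟨q, hqp, hqN, hcop⟩ := exists_prime_isCoprime_cyclotomic_geom_sum hN hS.1
    refine ih hS.2 (eq_zero_of_isCoprime_of_aeval_mul_eq_zero hcop (x := x) ?_ ?_)
    · rwa [Finset.prod_insert hmS, mul_assoc, map_mul, mul_assoc] at hSe
    · rw [← mul_assoc, ← map_mul, mul_comm, map_mul, mul_assoc]
      simp only [map_sum, map_pow, aeval_X, hq q hqp hqN, mul_zero]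

end Cyclotomic

section CyclicSubgroup

variable {G : Type*} [Group G] {c : G} {m N t : ℕ}

theorem normal_of_le_zpowers (hc : (Subgroup.zpowers c).Normal) {M : Subgroup G}
    (hM : M ≤ Subgroup.zpowers c) : M.Normal := by
  refine ⟨fun x hx g => ?_⟩
  obtain ⟨t, rfl⟩ := Subgroup.mem_zpowers_iff.1 (hM hx)
  obtain ⟨m, hm⟩ := Subgroup.mem_zpowers_iff.1 (hc.conj_mem c (Subgroup.mem_zpowers c) g)
  rw [← conj_zpow, ← hm, zpow_comm]
  exact M.zpow_mem hx m

theorem exists_dvd_eq_zpowers_pow {M : Subgroup G} (hM : M ≤ Subgroup.zpowers c) :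
    ∃ m, m ∣ orderOf c ∧ M = Subgroup.zpowers (c ^ m) := by
  have := Subgroup.isCyclic_of_le hM
  obtain ⟨y, rfl⟩ := M.isCyclic_iff_exists_zpowers_eq_top.1 this
  obtain ⟨i, rfl⟩ := Subgroup.mem_zpowers_iff.1 (hM (Subgroup.mem_zpowers y))
  refine ⟨Int.gcd i (orderOf c), by exact_mod_cast Int.gcd_dvd_right i (orderOf c),
    le_antisymm ?_ ?_⟩ <;> rw [Subgroup.zpowers_le, Subgroup.mem_zpowers_iff]
  · obtain ⟨r, hr⟩ := Int.gcd_dvd_left i (orderOf c)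
    exact ⟨r, by rw [← zpow_natCast, ← zpow_mul, ← hr]⟩
  · refine ⟨Int.gcdA i (orderOf c), ?_⟩
    rw [← zpow_natCast c, Int.gcd_eq_gcd_ab, zpow_add, zpow_mul, zpow_mul, zpow_natCast c,
      pow_orderOf_eq_one, one_zpow, mul_one]

theorem pow_mem_zpowers_pow_iff (hm : m ∣ orderOf c) :
    c ^ t ∈ Subgroup.zpowers (c ^ m) ↔ m ∣ t := by
  refine ⟨fun h => ?_, fun ⟨r, hr⟩ => ⟨r, by simp only [hr, pow_mul, zpow_natCast]⟩⟩
  obtain ⟨i, hi⟩ := Subgroup.mem_zpowers_iff.1 h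
  rw [← zpow_natCast, ← zpow_natCast, ← zpow_mul, zpow_eq_zpow_iff_modEq] at hi
  have hmt : (m : ℤ) ∣ t - m * i := (Int.natCast_dvd_natCast.2 hm).trans hi.dvd
  exact Int.natCast_dvd_natCast.1 ((Int.dvd_iff_dvd_of_dvd_sub hmt).2 (dvd_mul_right _ _))

theorem zpowers_pow_le_zpowers_pow_iff (hm : m ∣ orderOf c) :
    Subgroup.zpowers (c ^ t) ≤ Subgroup.zpowers (c ^ m) ↔ m ∣ t := by
  rw [Subgroup.zpowers_le, pow_mem_zpowers_pow_iff hm]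

theorem zpowers_pow_lt_zpowers_pow_div (hN : N ∣ orderOf c) (hN0 : N ≠ 0) {q : ℕ} (hq : q.Prime)
    (hqN : q ∣ N) : Subgroup.zpowers (c ^ N) < Subgroup.zpowers (c ^ (N / q)) := by
  have hqN' := Nat.div_dvd_of_dvd hqN
  rw [lt_iff_le_not_ge, zpowers_pow_le_zpowers_pow_iff (hqN'.trans hN),
    zpowers_pow_le_zpowers_pow_iff hN]
  refine ⟨hqN', fun h => (Nat.div_lt_self hN0.bot_lt hq.one_lt).not_ge ?_⟩
  exact Nat.le_of_dvd (Nat.div_pos (Nat.le_of_dvd hN0.bot_lt hqN) hq.pos) h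

theorem isMinimalNormalOver_zpowers_pow_iff (hN : N ∣ orderOf c) (hN0 : N ≠ 0) {M : Subgroup G} :
    IsMinimalNormalOver (Subgroup.zpowers c) (Subgroup.zpowers (c ^ N)) M ↔
      ∃ q, q.Prime ∧ q ∣ N ∧ M = Subgroup.zpowers (c ^ (N / q)) := by
  have hle (i : ℕ) : Subgroup.zpowers (c ^ i) ≤ Subgroup.zpowers c :=
    Subgroup.zpowers_le.2 (Subgroup.npow_mem_zpowers c i)
  constructor
  · intro hM
    obtain ⟨m, hm, rfl⟩ := exists_dvd_eq_zpowers_pow hM.1.1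
    obtain ⟨r, rfl⟩ := (zpowers_pow_le_zpowers_pow_iff hm).1 hM.1.2.2.le
    obtain ⟨q, hq, hqr⟩ := Nat.exists_prime_and_dvd (n := r) fun hr =>
      hM.1.2.2.ne (by rw [hr, mul_one])
    have hqN : q ∣ m * r := hqr.mul_left m
    have hmq : m ∣ m * r / q := by rw [Nat.mul_div_assoc m hqr]; exact dvd_mul_right _ _
    exact ⟨q, hq, hqN, hM.eq_of_ge
      ⟨hle _, inferInstance, zpowers_pow_lt_zpowers_pow_div hN hN0 hq hqN⟩
      ((zpowers_pow_le_zpowers_pow_iff hm).2 hmq)⟩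
  · rintro ⟨q, hq, ⟨m, rfl⟩, rfl⟩
    refine ⟨⟨hle _, inferInstance, zpowers_pow_lt_zpowers_pow_div hN hN0 hq ⟨m, rfl⟩⟩,
      fun M hM hMle => ?_⟩
    rw [Nat.mul_div_cancel_left m hq.pos] at hMle ⊢
    obtain ⟨i, hi, rfl⟩ := exists_dvd_eq_zpowers_pow hM.1
    obtain ⟨r, rfl⟩ :=
      (zpowers_pow_le_zpowers_pow_iff ((dvd_mul_left m q).trans hN)).1 hMle
    have hr : r ∣ q := by
      have := (zpowers_pow_le_zpowers_pow_iff hi).1 hM.2.2.le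
      rw [mul_comm q] at this
      exact Nat.dvd_of_mul_dvd_mul_left (Nat.pos_of_ne_zero (right_ne_zero_of_mul hN0)) this
    obtain rfl | rfl := (Nat.dvd_prime hq).1 hr
    · rw [mul_one]
    · exact absurd hM.2.2 (by rw [mul_comm m]; exact lt_irrefl _)

end CyclicSubgroup

section CyclicEps

open MonoidAlgebra Polynomial

variable {G : Type*} [Group G] [Finite G] {c : G} {N : ℕ}

/-- The idempotent `ε(⟨c⟩, ⟨c ^ N⟩)`, for `N ∣ orderOf c`: it cuts out the factor `ℚ(ζ_N)` of
`ℚ⟨c⟩ ≅ ∏ ℚ(ζ_N)`, on which `c` acts as a primitive `N`-th root of unity. -/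
noncomputable def cyclicEps (c : G) (N : ℕ) : MonoidAlgebra ℚ G :=
  epsElt (Subgroup.zpowers c) (Subgroup.zpowers (c ^ N))

theorem cyclicEps_mem_center (hc : (Subgroup.zpowers c).Normal) :
    cyclicEps c N ∈ Subalgebra.center ℚ (MonoidAlgebra ℚ G) :=
  epsElt_mem_center
    (normal_of_le_zpowers hc (Subgroup.zpowers_le.2 (Subgroup.npow_mem_zpowers c N)))
    fun _ hM => normal_of_le_zpowers hc hM.1.1

theorem hatElt_mul_cyclicEps {K : Subgroup G} (hK : K ≤ Subgroup.zpowers (c ^ N)) :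
    hatElt K * cyclicEps c N = cyclicEps c N := by
  rw [cyclicEps, ← hatElt_mul_epsElt, ← mul_assoc, hatElt_mul_hatElt_of_le hK]

theorem aeval_cyclotomic_mul_cyclicEps (hN : N ∣ orderOf c) :
    aeval (of ℚ G c) (cyclotomic N ℚ) * cyclicEps c N = 0 := by
  have hN0 : N ≠ 0 := ne_zero_of_dvd_ne_zero (orderOf_pos c).ne' hN
  have hcN : of ℚ G c ^ N * cyclicEps c N = cyclicEps c N := by
    rw [cyclicEps, ← hatElt_mul_epsElt, ← mul_assoc, ← map_pow,
      of_mul_hatElt (Subgroup.mem_zpowers _)]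
  refine aeval_cyclotomic_mul_eq_zero (Nat.cast_ne_zero.2 hN0) hcN fun q hq hqN => ?_
  set s := c ^ (N / q) with hs
  have hfix : of ℚ G s * ((∑ j ∈ Finset.range q, of ℚ G s ^ j) * cyclicEps c N) =
      (∑ j ∈ Finset.range q, of ℚ G s ^ j) * cyclicEps c N := by
    rw [← sub_eq_zero, ← sub_one_mul, ← mul_assoc, mul_geom_sum, hs, map_pow, ← pow_mul,
      Nat.div_mul_cancel hqN, sub_one_mul, hcN, sub_self]
  have hkill : hatElt (Subgroup.zpowers s) * cyclicEps c N = 0 :=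
    hatElt_mul_epsElt_of_isMinimalNormalOver
      ((isMinimalNormalOver_zpowers_pow_iff hN hN0).2 ⟨q, hq, hqN, rfl⟩)
  have hpow (j : ℕ) : hatElt (Subgroup.zpowers s) * of ℚ G s ^ j = hatElt (Subgroup.zpowers s) := by
    rw [← map_pow, hatElt_mul_of (Subgroup.npow_mem_zpowers s j)]
  rw [← map_pow, ← hs, ← hatElt_zpowers_mul hfix, ← mul_assoc, Finset.mul_sum]
  simp only [hpow, Finset.sum_mul, hkill, Finset.sum_const_zero]

theorem map_cyclicEps {L V : Type*} [Field L] [Ring V] [Algebra ℚ V]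
    (ψ : MonoidAlgebra ℚ G →ₐ[ℚ] V) (ι : L →+* V) {w : L} (hw : IsPrimitiveRoot w N)
    (hψ : ψ (of ℚ G c) = ι w) (hN : N ∣ orderOf c) : ψ (cyclicEps c N) = 1 := by
  have hN0 : N ≠ 0 := ne_zero_of_dvd_ne_zero (orderOf_pos c).ne' hN
  have hpow (t : ℕ) : ψ (of ℚ G (c ^ t)) = ι (w ^ t) := by rw [map_pow, map_pow, hψ, map_pow]
  refine map_epsElt ψ (map_hatElt_eq_one ψ fun m hm => ?_) fun M hM => ?_
  · obtain ⟨t, rfl⟩ := mem_powers_iff_mem_zpowers.2 hm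
    simp only [← pow_mul, hpow, pow_mul w, hw.pow_eq_one, one_pow, map_one]
  · obtain ⟨q, hq, hqN, rfl⟩ := (isMinimalNormalOver_zpowers_pow_iff hN hN0).1 hM
    refine map_hatElt_eq_zero ψ (Subgroup.mem_zpowers _) ?_
    rw [hpow, ← map_one ι, ← map_sub]
    exact (IsUnit.mk0 _ (sub_ne_zero.2 (hw.pow_ne_one_of_pos_of_lt
      (Nat.div_pos (Nat.le_of_dvd hN0.bot_lt hqN) hq.pos).ne'
      (Nat.div_lt_self hN0.bot_lt hq.one_lt)))).map ι

theorem eq_zero_of_forall_mul_cyclicEps {z : MonoidAlgebra ℚ G}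
    (hz : ∀ N, N ∣ orderOf c → z * cyclicEps c N = 0) : z = 0 := by
  have key (N : ℕ) (hN : N ∣ orderOf c) : z * hatElt (Subgroup.zpowers (c ^ N)) = 0 := by
    induction N using Nat.strong_induction_on with
    | _ N ih =>
      have hN0 : N ≠ 0 := ne_zero_of_dvd_ne_zero (orderOf_pos c).ne' hN
      rw [← mul_epsElt_of_forall fun M hM => ?_, ← cyclicEps, hz N hN]
      obtain ⟨q, hq, hqN, rfl⟩ := (isMinimalNormalOver_zpowers_pow_iff hN hN0).1 hM
      rw [mul_assoc, hatElt_mul_hatElt_of_le hM.1.2.2.le]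
      exact ih _ (Nat.div_lt_self hN0.bot_lt hq.one_lt) ((Nat.div_dvd_of_dvd hqN).trans hN)
  have hone : hatElt (Subgroup.zpowers (c ^ orderOf c)) = 1 :=
    map_hatElt_eq_one (AlgHom.id ℚ (MonoidAlgebra ℚ G)) fun m hm => by
      rw [pow_orderOf_eq_one, Subgroup.zpowers_one_eq_bot, Subgroup.mem_bot] at hm
      rw [hm, map_one, map_one]
  rw [← mul_one z, ← hone, key _ dvd_rfl]

end CyclicEps

section Component

theorem exists_mem_map_eq_one {R V : Type*} [Ring R] [Ring V] [IsSimpleRing V] (f : R →+* V)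
    (hf : Function.Surjective f) {I : TwoSidedIdeal R} {x : R} (hx : x ∈ I) (hfx : f x ≠ 0) :
    ∃ y ∈ I, f y = 1 := by
  let J : TwoSidedIdeal V := TwoSidedIdeal.mk' (f '' {x | x ∈ I}) ⟨0, I.zero_mem, map_zero f⟩
    (by
      rintro _ _ ⟨x, hx, rfl⟩ ⟨y, hy, rfl⟩
      exact ⟨x + y, I.add_mem hx hy, map_add f x y⟩)
    (by rintro _ ⟨x, hx, rfl⟩; exact ⟨-x, I.neg_mem hx, map_neg f x⟩)
    (by
      rintro v _ ⟨x, hx, rfl⟩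
      obtain ⟨y, rfl⟩ := hf v
      exact ⟨y * x, I.mul_mem_left _ _ hx, map_mul f y x⟩)
    (by
      rintro _ v ⟨x, hx, rfl⟩
      obtain ⟨y, rfl⟩ := hf v
      exact ⟨x * y, I.mul_mem_right _ _ hx, map_mul f x y⟩)
  have mem_J (v : V) : v ∈ J ↔ ∃ x ∈ I, f x = v := TwoSidedIdeal.mem_mk' _ _ _ _ _ _ _
  exact (mem_J 1).1 (IsSimpleRing.one_mem_of_ne_zero_mem J hfx ((mem_J _).2 ⟨x, hx, rfl⟩))

variable {R V : Type*} [Ring R] [Algebra ℚ R] [Ring V] [Algebra ℚ V] {e : R}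

theorem mem_span_singleton_of_mem_center (he : e ∈ Subalgebra.center ℚ R) {x : R} :
    x ∈ TwoSidedIdeal.span {e} ↔ x ∈ componentOf e := by
  refine ⟨fun hx => ?_, ?_⟩
  · induction hx using TwoSidedIdeal.span_induction with
    | mem x hx => exact ⟨1, (one_mul e).trans (Set.mem_singleton_iff.1 hx).symm⟩
    | zero => exact zero_mem _
    | add x y _ _ hx hy => exact add_mem hx hy
    | neg x _ hx => exact neg_mem hx
    | left_absorb a x _ hx =>
      obtain ⟨y, rfl⟩ := hx
      exact ⟨a * y, mul_assoc a y e⟩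
    | right_absorb b x _ hx =>
      obtain ⟨y, rfl⟩ := hx
      refine ⟨y * b, ?_⟩
      simp only [mul_assoc, Subalgebra.mem_center_iff.1 he b]
  · rintro ⟨y, rfl⟩
    exact TwoSidedIdeal.mul_mem_left _ _ _ (TwoSidedIdeal.subset_span rfl)

/-- The homomorphism `ψ : R → V` identifies the component `R e` with `V`: it is onto, takes `e`
to `1`, and `e` annihilates its kernel. Then `e² = e`, and for central `e` this says that `ψ` is
the projection of `R = R e ⊕ R (1 - e)` to its first summand. -/
structure IsComponentProjection (ψ : R →ₐ[ℚ] V) (e : R) : Prop where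
  surjective : Function.Surjective ψ
  map_eq_one : ψ e = 1
  mul_eq_zero : ∀ x, ψ x = 0 → x * e = 0

namespace IsComponentProjection

variable {ψ : R →ₐ[ℚ] V}

theorem exists_linearEquiv (h : IsComponentProjection ψ e) :
    ∃ φ : componentOf e ≃ₗ[ℚ] V, ∀ x y, φ (x * y) = φ x * φ y := by
  let f : componentOf e →ₗ[ℚ] V :=
    { toFun := fun x => ψ x
      map_add' := fun x y => map_add ψ (x : R) y
      map_smul' := fun r x => map_smul ψ r (x : R) }
  have map_mul_e (x : R) : ψ (x * e) = ψ x := by rw [map_mul, h.map_eq_one, mul_one]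
  refine ⟨LinearEquiv.ofBijective f ⟨?_, fun v => ?_⟩, fun x y => map_mul ψ (x : R) y⟩
  · rw [injective_iff_map_eq_zero]
    rintro ⟨_, x, rfl⟩ hx
    exact Subtype.ext (h.mul_eq_zero x ((map_mul_e x).symm.trans hx))
  · obtain ⟨x, rfl⟩ := h.surjective v
    exact ⟨⟨x * e, x, rfl⟩, map_mul_e x⟩

theorem mul_eq_self (h : IsComponentProjection ψ e) {x : R} (hx : ψ x = 1) : x * e = e := by
  have : (x - 1) * e = 0 := h.mul_eq_zero _ (by rw [map_sub, hx, map_one, sub_self])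
  rwa [sub_mul, one_mul, sub_eq_zero] at this

theorem ne_zero [Nontrivial V] (h : IsComponentProjection ψ e) : e ≠ 0 := by
  rintro rfl
  exact zero_ne_one ((map_zero ψ).symm.trans h.map_eq_one)

theorem isAtom_span [IsSimpleRing V] (h : IsComponentProjection ψ e)
    (he : e ∈ Subalgebra.center ℚ R) : IsAtom (TwoSidedIdeal.span {e}) := by
  have he_mem : e ∈ TwoSidedIdeal.span {e} := TwoSidedIdeal.subset_span rfl
  refine ⟨fun hbot => h.ne_zero ?_, fun J hJ => ?_⟩
  · rwa [hbot, TwoSidedIdeal.mem_bot] at he_mem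
  · by_contra hJ0
    obtain ⟨x, hxJ, hx0⟩ : ∃ x ∈ J, x ≠ 0 := by
      by_contra! hJ'
      exact hJ0 (eq_bot_iff.2 fun x hx => (TwoSidedIdeal.mem_bot R).2 (hJ' x hx))
    have hψx : ψ x ≠ 0 := fun hψx => hx0 <| by
      obtain ⟨y, rfl⟩ := (mem_span_singleton_of_mem_center he).1 (hJ.le hxJ)
      rw [map_mul, h.map_eq_one, mul_one] at hψx
      exact h.mul_eq_zero y hψx
    obtain ⟨y, hyJ, hy⟩ := exists_mem_map_eq_one (ψ : R →+* V) h.surjective hxJ hψx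
    have heJ : e ∈ J := h.mul_eq_self hy ▸ J.mul_mem_right _ _ hyJ
    exact hJ.not_ge (TwoSidedIdeal.span_le.2 (Set.singleton_subset_iff.2 heJ))

theorem isSimpleComponent [IsSimpleRing V] (h : IsComponentProjection ψ e)
    (he : e ∈ Subalgebra.center ℚ R) : IsSimpleComponent (componentOf e) :=
  ⟨_, h.isAtom_span he, Set.ext fun _ => (mem_span_singleton_of_mem_center he).symm⟩

theorem exists_mul_ne_mul (h : IsComponentProjection ψ e) (hV : ∃ f f' : V, f * f' ≠ f' * f) :
    ∃ x ∈ componentOf e, ∃ y ∈ componentOf e, x * y ≠ y * x := by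
  obtain ⟨φ, hφ⟩ := h.exists_linearEquiv
  obtain ⟨f, f', hff'⟩ := hV
  refine ⟨φ.symm f, (φ.symm f).2, φ.symm f', (φ.symm f').2, fun hcomm => hff' ?_⟩
  have : φ.symm f * φ.symm f' = φ.symm f' * φ.symm f := Subtype.ext hcomm
  simpa only [hφ, LinearEquiv.apply_symm_apply] using congrArg φ this

end IsComponentProjection

theorem isSimpleComponent_and_not_commutative_iff {ι : Type*} {e : ι → R}
    (hsimple : ∀ i, IsSimpleComponent (componentOf (e i)))
    (hcomm : ∀ i, ∃ x ∈ componentOf (e i), ∃ y ∈ componentOf (e i), x * y ≠ y * x)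
    (hrest : ∀ x, (∀ i, x * e i = 0) → x ∈ Subalgebra.center ℚ R)
    {B : NonUnitalSubalgebra ℚ R} :
    (IsSimpleComponent B ∧ ∃ x ∈ B, ∃ y ∈ B, x * y ≠ y * x) ↔ ∃ i, B = componentOf (e i) := by
  refine ⟨?_, fun ⟨i, hB⟩ => hB ▸ ⟨hsimple i, hcomm i⟩⟩
  rintro ⟨⟨I, hI, hBI⟩, x, hx, y, -, hxy⟩
  have mem_B (z : R) : z ∈ B ↔ z ∈ I := Set.ext_iff.1 hBI z
  -- Otherwise `I ∩ R e_i = 0` for all `i`, so `e_i` annihilates `I`.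
  by_contra! hB
  refine hxy (Subalgebra.mem_center_iff.1 (hrest x fun i => ?_) y).symm
  obtain ⟨J, hJ, hBJ⟩ := hsimple i
  have mem_J (z : R) : z ∈ componentOf (e i) ↔ z ∈ J := Set.ext_iff.1 hBJ z
  have hIJ : I ≠ J := fun hIJ => hB i (SetLike.ext fun z => by rw [mem_B, mem_J, hIJ])
  have hx_mem : x * e i ∈ I ⊓ J := (TwoSidedIdeal.mem_inf R).2
    ⟨I.mul_mem_right _ _ ((mem_B x).1 hx), (mem_J _).1 ⟨x, rfl⟩⟩
  rwa [(hI.disjoint_of_ne hJ hIJ).eq_bot, TwoSidedIdeal.mem_bot] at hx_mem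

end Component

section Group

variable {G : Type*} [Group G]

theorem zpowers_pow_eq_of_coprime {x : G} {j : ℕ} (h : j.Coprime (orderOf x)) :
    Subgroup.zpowers (x ^ j) = Subgroup.zpowers x :=
  le_antisymm (Subgroup.zpowers_le.2 (Subgroup.npow_mem_zpowers x j))
    (Subgroup.zpowers_le.2 (mem_zpowers_pow_iff.2 h))

theorem closure_pair_eq_sup_zpowers (x y : G) :
    Subgroup.closure {x, y} = Subgroup.zpowers x ⊔ Subgroup.zpowers y := by
  rw [Set.insert_eq, Subgroup.closure_union, Subgroup.zpowers_eq_closure,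
    Subgroup.zpowers_eq_closure]

theorem zpowers_mul_eq_closure_of_coprime {x y : G} (hxy : Commute x y)
    (h : (orderOf x).Coprime (orderOf y)) :
    Subgroup.zpowers (x * y) = Subgroup.closure {x, y} := by
  refine le_antisymm ?_ ((Subgroup.closure_le _).2 ?_)
  · rw [Subgroup.zpowers_le]
    exact mul_mem (Subgroup.subset_closure (by simp)) (Subgroup.subset_closure (by simp))
  · have mem_of_modEq (i j : ℕ) : x ^ i * y ^ j ∈ Subgroup.zpowers (x * y) := by
      obtain ⟨t, hi, hj⟩ := Nat.chineseRemainder h i j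
      rw [← pow_eq_pow_iff_modEq.2 hi, ← pow_eq_pow_iff_modEq.2 hj, ← hxy.mul_pow]
      exact Subgroup.npow_mem_zpowers _ t
    rintro _ (rfl | rfl)
    · simpa using mem_of_modEq 1 0
    · simpa using mem_of_modEq 0 1

theorem pow_mul_pow_mul_inv {x y : G} {s : ℕ} (h : y * x * y⁻¹ = x ^ s) (i j : ℕ) :
    y ^ j * x ^ i * (y ^ j)⁻¹ = x ^ (i * s ^ j) := by
  induction j with
  | zero => simp
  | succ j ih =>
    calc y ^ (j + 1) * x ^ i * (y ^ (j + 1))⁻¹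
        = y * (y ^ j * x ^ i * (y ^ j)⁻¹) * y⁻¹ := by rw [pow_succ']; group
      _ = x ^ (i * s ^ (j + 1)) := by rw [ih, ← conj_pow, h, ← pow_mul]; ring_nf

theorem exists_monoidHom_of_isComplement' {M : Type*} [Group M] {N H : Subgroup G} [hN : N.Normal]
    (h : N.IsComplement' H) (f : N →* M) (g : H →* M)
    (hfg : ∀ (x : N) (y : H), f ⟨y * x * (y : G)⁻¹, hN.conj_mem x x.2 y⟩ = g y * f x * (g y)⁻¹) :
    ∃ F : G →* M, (∀ x : N, F x = f x) ∧ ∀ y : H, F y = g y := by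
  let e := SemidirectProduct.mulEquivSubgroup h
  let F := SemidirectProduct.lift (φ := N.normalizerMonoidHom.comp
    (Subgroup.inclusion (N.normalizer_eq_top ▸ le_top))) f g fun y => MonoidHom.ext fun x => hfg x y
  have he (x : N) (y : H) : e.symm (x * y) = ⟨x, y⟩ := e.symm_apply_eq.2 rfl
  refine ⟨F.comp e.symm.toMonoidHom, fun x => ?_, fun y => ?_⟩
  · have hx : e.symm x = SemidirectProduct.inl x := by simpa using he x 1
    exact (congrArg F hx).trans (SemidirectProduct.lift_inl _ _ _ x)
  · have hy : e.symm y = SemidirectProduct.inr y := by simpa using he 1 y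
    exact (congrArg F hy).trans (SemidirectProduct.lift_inr _ _ _ y)

theorem exists_monoidHom_zpowers {M : Type*} [Group M] {x : G} {y : M}
    (h : orderOf y ∣ orderOf x) :
    ∃ f : Subgroup.zpowers x →* M, ∀ i : ℕ, f ⟨x ^ i, Subgroup.npow_mem_zpowers x i⟩ = y ^ i := by
  let g : Subgroup.zpowers x := ⟨x, Subgroup.mem_zpowers x⟩
  have hg (u : Subgroup.zpowers x) : u ∈ Subgroup.zpowers g := by
    obtain ⟨u, i, rfl⟩ := u
    exact ⟨i, rfl⟩
  have hord : orderOf y ∣ orderOf g := by rwa [Subgroup.orderOf_mk]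
  exact ⟨monoidHomOfForallMemZpowers hg hord, fun i => (map_pow _ g i).trans
    (congrArg (· ^ i) (monoidHomOfForallMemZpowers_apply_gen hg hord))⟩

theorem exists_monoidHom_of_isComplement'_zpowers [Finite G] {M : Type*} [Group M] {a b : G}
    (hnormal : (Subgroup.zpowers a).Normal)
    (h : (Subgroup.zpowers a).IsComplement' (Subgroup.zpowers b)) {x y : M} {s : ℕ}
    (hx : orderOf x ∣ orderOf a) (hy : orderOf y ∣ orderOf b)
    (hab : b * a * b⁻¹ = a ^ s) (hxy : y * x * y⁻¹ = x ^ s) :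
    ∃ F : G →* M, F a = x ∧ F b = y := by
  obtain ⟨f, hf⟩ := exists_monoidHom_zpowers hx
  obtain ⟨g, hg⟩ := exists_monoidHom_zpowers hy
  obtain ⟨F, hFf, hFg⟩ := exists_monoidHom_of_isComplement' h f g <| by
    rintro ⟨u, hu⟩ ⟨v, hv⟩
    obtain ⟨i, rfl⟩ := mem_powers_iff_mem_zpowers.2 hu
    obtain ⟨j, rfl⟩ := mem_powers_iff_mem_zpowers.2 hv
    simp only [pow_mul_pow_mul_inv hab, hf, hg, pow_mul_pow_mul_inv hxy]
  exact ⟨F, (hFf ⟨a, Subgroup.mem_zpowers a⟩).trans (by simpa using hf 1),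
    (hFg ⟨b, Subgroup.mem_zpowers b⟩).trans (by simpa using hg 1)⟩

section ConjZMod

variable {a b : G} {p : ℕ} [NeZero p] {r : (ZMod p)ˣ}

theorem exists_unit_conj_eq_pow (ha : orderOf a = p) (hnormal : (Subgroup.zpowers a).Normal)
    (b : G) : ∃ r : (ZMod p)ˣ, b * a * b⁻¹ = a ^ (r : ZMod p).val := by
  have hfin : IsOfFinOrder a := orderOf_pos_iff.1 (ha ▸ NeZero.pos p)
  obtain ⟨t, ht : a ^ t = _⟩ := hfin.mem_powers_iff_mem_zpowers.2
    (hnormal.conj_mem a (Subgroup.mem_zpowers a) b)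
  have hcop : t.Coprime p := by
    refine ha ▸ mem_zpowers_pow_iff.1 ?_
    obtain ⟨m, hm⟩ := Subgroup.mem_zpowers_iff.1
      (hnormal.conj_mem a (Subgroup.mem_zpowers a) b⁻¹)
    refine Subgroup.mem_zpowers_iff.2 ⟨m, ?_⟩
    rw [ht, conj_zpow, hm]
    group
  refine ⟨ZMod.unitOfCoprime t hcop, ?_⟩
  rw [ZMod.coe_unitOfCoprime, ZMod.val_natCast, ← ha, pow_mod_orderOf, ht]

theorem pow_conj_eq_pow_val (ha : orderOf a = p) (hr : b * a * b⁻¹ = a ^ (r : ZMod p).val)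
    (j : ℕ) : b ^ j * a * (b ^ j)⁻¹ = a ^ ((r ^ j : (ZMod p)ˣ) : ZMod p).val := by
  have h := pow_mul_pow_mul_inv hr 1 j
  rw [pow_one, one_mul] at h
  rw [h, pow_eq_pow_iff_modEq, ha, ← ZMod.natCast_eq_natCast_iff, Nat.cast_pow,
    ZMod.natCast_zmod_val, ZMod.natCast_zmod_val, Units.val_pow_eq_pow_val]

theorem commute_pow_iff_orderOf_dvd (ha : orderOf a = p)
    (hr : b * a * b⁻¹ = a ^ (r : ZMod p).val) {j : ℕ} : Commute a (b ^ j) ↔ orderOf r ∣ j := by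
  have h : Commute a (b ^ j) ↔ b ^ j * a * (b ^ j)⁻¹ = a := by
    rw [mul_inv_eq_iff_eq_mul]
    exact eq_comm
  rw [h, pow_conj_eq_pow_val ha hr, orderOf_dvd_iff_pow_eq_one, Units.ext_iff]
  nth_rw 2 [← pow_one a]
  rw [pow_eq_pow_iff_modEq, ha, ← ZMod.natCast_eq_natCast_iff, ZMod.natCast_zmod_val, Nat.cast_one,
    Units.val_one]

theorem zpowers_inf_centralizer (ha : orderOf a = p) (hb : IsOfFinOrder b)
    (hr : b * a * b⁻¹ = a ^ (r : ZMod p).val) :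
    Subgroup.zpowers b ⊓ Subgroup.centralizer {a} = Subgroup.zpowers (b ^ orderOf r) := by
  ext x
  rw [Subgroup.mem_inf, Subgroup.mem_centralizer_singleton_iff]
  constructor
  · rintro ⟨hx, hax⟩
    obtain ⟨j, rfl⟩ := hb.mem_powers_iff_mem_zpowers.2 hx
    obtain ⟨i, rfl⟩ := (commute_pow_iff_orderOf_dvd ha hr).1 (Commute.symm hax)
    simpa only [pow_mul] using Subgroup.npow_mem_zpowers _ i
  · intro hx
    obtain ⟨i, rfl⟩ := (hb.pow (n := orderOf r)).mem_powers_iff_mem_zpowers.2 hx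
    have := ((commute_pow_iff_orderOf_dvd ha hr).2 dvd_rfl).pow_right i
    exact ⟨pow_mem (Subgroup.npow_mem_zpowers b _) i, this.symm⟩

theorem orderOf_eq_orderOf_mul_card (ha : orderOf a = p) (hb : IsOfFinOrder b)
    (hr : b * a * b⁻¹ = a ^ (r : ZMod p).val) :
    orderOf b =
      orderOf r * Nat.card (Subgroup.zpowers b ⊓ Subgroup.centralizer {a} : Subgroup G) := by
  have hdvd : orderOf r ∣ orderOf b := by
    rw [← commute_pow_iff_orderOf_dvd ha hr, pow_orderOf_eq_one]
    exact Commute.one_right a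
  rw [zpowers_inf_centralizer ha hb hr, Nat.card_zpowers,
    orderOf_pow_of_dvd (orderOf_pos r).ne' hdvd, Nat.mul_div_cancel' hdvd]

end ConjZMod

end Group

/-- The group `G = ⟨a⟩ ⋊ ⟨b⟩` of the theorem: `⟨a⟩` is normal of order `p`, the order
`orderOf r * k` of `b` is prime to `p`, and `b` acts on `⟨a⟩` by `a ↦ a ^ r`. Thus
`b ^ orderOf r` is central, of order `k`. -/
structure IsSplitMetacyclic {G : Type*} [Group G] (a b : G) {p : ℕ} (r : (ZMod p)ˣ) (k : ℕ) :
    Prop where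
  orderOf_left : orderOf a = p
  orderOf_right : orderOf b = orderOf r * k
  coprime : p.Coprime (orderOf r * k)
  normal : (Subgroup.zpowers a).Normal
  isComplement : (Subgroup.zpowers a).IsComplement' (Subgroup.zpowers b)
  conj : b * a * b⁻¹ = a ^ (r : ZMod p).val

namespace IsSplitMetacyclic

variable {G : Type*} [Group G] {a b : G} {p k : ℕ} {r : (ZMod p)ˣ}

theorem commutator_le (hG : IsSplitMetacyclic a b r k) : commutator G ≤ Subgroup.zpowers a :=
  have := hG.normal
  this.commutator_le_of_self_sup_commutative_eq_top hG.isComplement.sup_eq_top inferInstance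

theorem coprime_right (hG : IsSplitMetacyclic a b r k) : p.Coprime k :=
  hG.coprime.coprime_mul_left_right

variable [Finite G]

theorem neZero (hG : IsSplitMetacyclic a b r k) : NeZero p :=
  ⟨hG.orderOf_left ▸ (orderOf_pos a).ne'⟩

theorem orderOf_pos_unit (hG : IsSplitMetacyclic a b r k) : 0 < orderOf r :=
  Nat.pos_of_mul_pos_right (hG.orderOf_right ▸ orderOf_pos b)

theorem pos (hG : IsSplitMetacyclic a b r k) : 0 < k :=
  Nat.pos_of_mul_pos_left (hG.orderOf_right ▸ orderOf_pos b)

theorem commute (hG : IsSplitMetacyclic a b r k) : Commute a (b ^ orderOf r) :=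
  have := hG.neZero
  (commute_pow_iff_orderOf_dvd hG.orderOf_left hG.conj).2 dvd_rfl

theorem orderOf_pow (hG : IsSplitMetacyclic a b r k) : orderOf (b ^ orderOf r) = k := by
  rw [orderOf_pow_of_dvd hG.orderOf_pos_unit.ne' (hG.orderOf_right ▸ dvd_mul_right _ k),
    hG.orderOf_right, Nat.mul_div_cancel_left _ hG.orderOf_pos_unit]

theorem orderOf_mul_pow (hG : IsSplitMetacyclic a b r k) :
    orderOf (a * b ^ orderOf r) = p * k := by
  have hcop : (orderOf a).Coprime (orderOf (b ^ orderOf r)) := by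
    rw [hG.orderOf_left, hG.orderOf_pow]
    exact hG.coprime_right
  rw [hG.commute.orderOf_mul_eq_mul_orderOf_of_coprime hcop, hG.orderOf_left, hG.orderOf_pow]

theorem zpowers_mul_pow (hG : IsSplitMetacyclic a b r k) :
    Subgroup.zpowers (a * b ^ orderOf r) = Subgroup.closure {a, b ^ orderOf r} := by
  refine zpowers_mul_eq_closure_of_coprime hG.commute ?_
  rw [hG.orderOf_left, hG.orderOf_pow]
  exact hG.coprime_right

theorem exists_eq_pow_mul_pow (hG : IsSplitMetacyclic a b r k) (g : G) :
    ∃ i j : ℕ, g = a ^ i * b ^ j := by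
  obtain ⟨⟨⟨x, hx⟩, ⟨y, hy⟩⟩, hxy⟩ := hG.isComplement.2 g
  obtain ⟨i, rfl⟩ := mem_powers_iff_mem_zpowers.2 hx
  obtain ⟨j, rfl⟩ := mem_powers_iff_mem_zpowers.2 hy
  exact ⟨i, j, hxy.symm⟩

theorem exists_eq_pow_mul_pow_lt (hG : IsSplitMetacyclic a b r k) (g : G) :
    ∃ t i : ℕ, i < orderOf r ∧ g = (a * b ^ orderOf r) ^ t * b ^ i := by
  obtain ⟨i, j, rfl⟩ := hG.exists_eq_pow_mul_pow g
  have ha : a ∈ Subgroup.zpowers (a * b ^ orderOf r) :=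
    hG.zpowers_mul_pow ▸ Subgroup.subset_closure (Set.mem_insert _ _)
  have hb : b ^ orderOf r ∈ Subgroup.zpowers (a * b ^ orderOf r) :=
    hG.zpowers_mul_pow ▸ Subgroup.subset_closure (Set.mem_insert_of_mem _ rfl)
  obtain ⟨t, ht : (a * b ^ orderOf r) ^ t = a ^ i * (b ^ orderOf r) ^ (j / orderOf r)⟩ :=
    mem_powers_iff_mem_zpowers.2 (mul_mem (pow_mem ha i) (pow_mem hb _))
  refine ⟨t, j % orderOf r, Nat.mod_lt _ hG.orderOf_pos_unit, ?_⟩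
  rw [ht, mul_assoc, ← pow_mul, ← pow_add, Nat.div_add_mod]

theorem pow_mem_center (hG : IsSplitMetacyclic a b r k) : b ^ orderOf r ∈ Subgroup.center G := by
  refine Subgroup.mem_center_iff.2 fun g => ?_
  obtain ⟨i, j, rfl⟩ := hG.exists_eq_pow_mul_pow g
  exact (hG.commute.pow_left i).mul_left (Commute.pow_pow_self b j _)

theorem normal_zpowers (hG : IsSplitMetacyclic a b r k) :
    (Subgroup.zpowers (a * b ^ orderOf r)).Normal := by
  have := hG.normal
  have : (Subgroup.zpowers (b ^ orderOf r)).Normal :=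
    ⟨fun x hx g => by
      have hx_center := Subgroup.zpowers_le.2 hG.pow_mem_center hx
      rwa [Subgroup.mem_center_iff.1 hx_center g, mul_inv_cancel_right]⟩
  rw [hG.zpowers_mul_pow, closure_pair_eq_sup_zpowers]
  infer_instance

theorem zpowers_pow_mul (hG : IsSplitMetacyclic a b r k) (h : ℕ) :
    Subgroup.zpowers ((a * b ^ orderOf r) ^ (p * h)) = Subgroup.zpowers (b ^ (h * orderOf r)) := by
  have hcop : p.Coprime (orderOf (b ^ (h * orderOf r))) :=
    hG.coprime.coprime_dvd_right (hG.orderOf_right ▸ orderOf_pow_dvd _)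
  have hap : a ^ p = 1 := orderOf_dvd_iff_pow_eq_one.1 hG.orderOf_left.dvd
  rw [hG.commute.mul_pow, pow_mul a, hap, one_pow, one_mul, ← zpowers_pow_eq_of_coprime hcop,
    ← pow_mul, ← pow_mul]
  ring_nf

theorem zpowers_pow (hG : IsSplitMetacyclic a b r k) :
    Subgroup.zpowers ((a * b ^ orderOf r) ^ k) = Subgroup.zpowers a := by
  have hcop : k.Coprime (orderOf a) := hG.orderOf_left ▸ hG.coprime_right.symm
  have hbk : (b ^ orderOf r) ^ k = 1 := orderOf_dvd_iff_pow_eq_one.1 hG.orderOf_pow.dvd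
  rw [hG.commute.mul_pow, hbk, mul_one, zpowers_pow_eq_of_coprime hcop]

theorem cyclicEps_mem_center (hG : IsSplitMetacyclic a b r k) (N : ℕ) :
    cyclicEps (a * b ^ orderOf r) N ∈ Subalgebra.center ℚ (MonoidAlgebra ℚ G) :=
  _root_.cyclicEps_mem_center hG.normal_zpowers

theorem compB_eq (hG : IsSplitMetacyclic a b r k) (h : ℕ) :
    compB a b (orderOf r * k) k h = componentOf (cyclicEps (a * b ^ orderOf r) (p * h)) := by
  rw [compB, Nat.mul_div_cancel _ hG.pos, ← hG.zpowers_mul_pow, ← hG.zpowers_pow_mul,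
    eElt_eq_epsElt (hG.cyclicEps_mem_center _), cyclicEps]

theorem mem_center_of_forall_mul_cyclicEps_eq_zero [hp : Fact p.Prime]
    (hG : IsSplitMetacyclic a b r k) {x : MonoidAlgebra ℚ G}
    (hx : ∀ h, h ∣ k → x * cyclicEps (a * b ^ orderOf r) (p * h) = 0) :
    x ∈ Subalgebra.center ℚ (MonoidAlgebra ℚ G) := by
  have := hG.normal
  refine mem_center_of_mul_hatElt_eq_self hG.commutator_le (sub_eq_zero.1 ?_).symm
  refine eq_zero_of_forall_mul_cyclicEps (c := a * b ^ orderOf r) fun N hN => ?_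
  rw [hG.orderOf_mul_pow] at hN
  by_cases hpN : p ∣ N
  · obtain ⟨h, rfl⟩ := hpN
    have hx0 := hx h (Nat.dvd_of_mul_dvd_mul_left hp.out.pos hN)
    rw [sub_mul, mul_assoc x, Subalgebra.mem_center_iff.1 (hG.cyclicEps_mem_center _)
      (hatElt _), ← mul_assoc, hx0, zero_mul, sub_zero]
  · have hNk : N ∣ k := ((hp.out.coprime_iff_not_dvd.2 hpN).symm).dvd_of_dvd_mul_left hN
    have ha : Subgroup.zpowers a ≤ Subgroup.zpowers ((a * b ^ orderOf r) ^ N) := by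
      rw [← hG.zpowers_pow]
      exact (zpowers_pow_le_zpowers_pow_iff (hNk.trans (hG.orderOf_mul_pow ▸ dvd_mul_left k p))).2
        hNk
    rw [sub_mul, mul_assoc, hatElt_mul_cyclicEps ha, sub_self]

theorem pow (hG : IsSplitMetacyclic a b r k) {j : ℕ} (hj : j.Coprime (orderOf r * k)) :
    IsSplitMetacyclic a (b ^ j) (r ^ j) k := by
  have := hG.neZero
  have hrj : orderOf (r ^ j) = orderOf r := hj.coprime_mul_right_right.symm.orderOf_pow
  exact
    { orderOf_left := hG.orderOf_left
      orderOf_right := by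
        rw [← hG.orderOf_right] at hj
        rw [hj.symm.orderOf_pow, hG.orderOf_right, hrj]
      coprime := hrj ▸ hG.coprime
      normal := hG.normal
      isComplement := by
        rw [zpowers_pow_eq_of_coprime (hG.orderOf_right ▸ hj)]
        exact hG.isComplement
      conj := pow_conj_eq_pow_val hG.orderOf_left hG.conj j }

theorem cyclicEps_pow (hG : IsSplitMetacyclic a b r k) {j : ℕ} (hj : j.Coprime (orderOf r * k))
    (h : ℕ) : cyclicEps (a * (b ^ j) ^ orderOf (r ^ j)) (p * h) =
      cyclicEps (a * b ^ orderOf r) (p * h) := by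
  have zpowers_pow_pow (m : ℕ) :
      Subgroup.zpowers ((b ^ j) ^ m) = Subgroup.zpowers (b ^ m) := by
    rw [← pow_mul, mul_comm, pow_mul]
    exact zpowers_pow_eq_of_coprime
      (hj.coprime_dvd_right (hG.orderOf_right ▸ orderOf_pow_dvd m))
  rw [cyclicEps, cyclicEps, (hG.pow hj).zpowers_pow_mul, (hG.pow hj).zpowers_mul_pow,
    hG.zpowers_pow_mul, hG.zpowers_mul_pow, hj.coprime_mul_right_right.symm.orderOf_pow,
    closure_pair_eq_sup_zpowers, closure_pair_eq_sup_zpowers, zpowers_pow_pow, zpowers_pow_pow]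

end IsSplitMetacyclic

theorem exists_isSplitMetacyclic {G : Type*} [Group G] [Finite G] {a b : G} {p n k : ℕ}
    (hp : p.Prime) (hpn : ¬ p ∣ n) (ha : orderOf a = p) (hb : orderOf b = n)
    (hnormal : (Subgroup.zpowers a).Normal)
    (hcompl : (Subgroup.zpowers a).IsComplement' (Subgroup.zpowers b))
    (hk : Nat.card (Subgroup.zpowers b ⊓ Subgroup.centralizer {a} : Subgroup G) = k) :
    ∃ r : (ZMod p)ˣ, n = orderOf r * k ∧ IsSplitMetacyclic a b r k := by
  have : NeZero p := ⟨hp.ne_zero⟩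
  obtain ⟨r, hr⟩ := exists_unit_conj_eq_pow ha hnormal b
  have hn : n = orderOf r * k := by
    rw [← hb, ← hk, orderOf_eq_orderOf_mul_card ha (isOfFinOrder_of_finite b) hr]
  exact ⟨r, hn, ha, hb.trans hn, hn ▸ hp.coprime_iff_not_dvd.2 hpn, hnormal, hcompl, hr⟩

theorem exists_coprime_pow_eq {R : Type*} [CommRing R] [IsDomain R] {x y : Rˣ} {n : ℕ} [NeZero n]
    (hxy : orderOf x = orderOf y) (hn : orderOf x ∣ n) : ∃ j : ℕ, j.Coprime n ∧ x ^ j = y := by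
  have : NeZero (orderOf x) := ⟨ne_zero_of_dvd_ne_zero (NeZero.ne n) hn⟩
  have hx := IsPrimitiveRoot.coe_units_iff.2 (IsPrimitiveRoot.orderOf x)
  have hy := IsPrimitiveRoot.coe_units_iff.2 (hxy ▸ IsPrimitiveRoot.orderOf y)
  obtain ⟨i, -, hi, hiy⟩ := hx.isPrimitiveRoot_iff.1 hy
  obtain ⟨u, hu⟩ := ZMod.unitsMap_surjective hn (ZMod.unitOfCoprime i hi)
  have hui : (((u : ZMod n).val : ℕ) : ZMod (orderOf x)) = i := by
    rw [ZMod.natCast_val, ← ZMod.unitsMap_val hn, hu, ZMod.coe_unitOfCoprime]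
  refine ⟨(u : ZMod n).val, ZMod.val_coe_unit_coprime u, ?_⟩
  rw [← Units.ext ((Units.val_pow_eq_pow_val x i).trans hiy), pow_eq_pow_iff_modEq,
    ← ZMod.natCast_eq_natCast_iff, hui]

theorem isPrimitiveRoot_mul_of_coprime {M : Type*} [CommMonoid M] {x y : M} {m n : ℕ}
    (hx : IsPrimitiveRoot x m) (hy : IsPrimitiveRoot y n) (h : m.Coprime n) :
    IsPrimitiveRoot (x * y) (m * n) := by
  rw [hx.eq_orderOf, hy.eq_orderOf] at h ⊢
  rw [← (Commute.all x y).orderOf_mul_eq_mul_orderOf_of_coprime h]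
  exact IsPrimitiveRoot.orderOf _

namespace CyclicAlgebra

open MonoidAlgebra Polynomial CrossedProduct

variable {E L : Type*} [Field E] [Field L] [Algebra E L] [FiniteDimensional E L]
  [Algebra ℚ E] [Algebra ℚ L] [IsScalarTower ℚ E L]
  {σ : L ≃ₐ[E] L} {hσ : ∀ g, g ∈ Subgroup.zpowers σ} {z : Eˣ} {ω : L}
  {G : Type*} [Group G] {a b : G} {ψ : MonoidAlgebra ℚ G →ₐ[ℚ] CyclicAlgebra σ hσ z}

theorem map_of_mul_pow (hψa : ψ (of ℚ G a) = ofField _ ω)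
    (hψb : ψ (of ℚ G b) = gen hσ z) :
    ψ (of ℚ G (a * b ^ orderOf σ)) = ofField _ (ω * algebraMap E L z) := by
  rw [map_mul, map_pow, map_mul, map_pow, hψa, hψb, gen_pow_orderOf, map_mul]

theorem map_sum_aeval (hψa : ψ (of ℚ G a) = ofField _ ω)
    (hψb : ψ (of ℚ G b) = gen hσ z) (q : ℕ → ℚ[X]) :
    ψ (∑ i ∈ Finset.range (orderOf σ),
        aeval (of ℚ G (a * b ^ orderOf σ)) (q i) * of ℚ G b ^ i) =
      ∑ i ∈ Finset.range (orderOf σ),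
        ofField _ (aeval (ω * algebraMap E L z) (q i)) * gen hσ z ^ i := by
  have haeval (q : ℚ[X]) : ψ (aeval (of ℚ G (a * b ^ orderOf σ)) q) =
      ofField _ (aeval (ω * algebraMap E L z) q) := by
    rw [← aeval_algHom_apply, map_of_mul_pow hψa hψb]
    exact aeval_algHom_apply (ofField _).toRatAlgHom _ q
  simp only [map_sum, map_mul ψ, map_pow ψ, haeval, hψb]

end CyclicAlgebra

namespace IsSplitMetacyclic

open MonoidAlgebra Polynomial CrossedProduct

variable {G : Type*} [Group G] [Finite G] {a b : G} {p k : ℕ} {r : (ZMod p)ˣ}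

theorem exists_eq_sum (hG : IsSplitMetacyclic a b r k) (x : MonoidAlgebra ℚ G) :
    ∃ f : ℕ → ℚ[X], x = ∑ i ∈ Finset.range (orderOf r),
      aeval (of ℚ G (a * b ^ orderOf r)) (f i) * of ℚ G b ^ i := by
  induction x using MonoidAlgebra.induction_on with
  | of g =>
    obtain ⟨t, i, hi, rfl⟩ := hG.exists_eq_pow_mul_pow_lt g
    refine ⟨Pi.single i (X ^ t), ?_⟩
    rw [Finset.sum_eq_single_of_mem i (Finset.mem_range.2 hi)]
    · rw [Pi.single_eq_same, map_pow, aeval_X, map_mul, map_pow, map_pow]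
    · intro j _ hj
      rw [Pi.single_eq_of_ne hj, map_zero, zero_mul]
  | add x y hx hy =>
    obtain ⟨f, rfl⟩ := hx
    obtain ⟨g, rfl⟩ := hy
    exact ⟨f + g, by simp [add_mul, Finset.sum_add_distrib]⟩
  | smul q x hx =>
    obtain ⟨f, rfl⟩ := hx
    exact ⟨fun i => q • f i, by simp [Finset.smul_sum]⟩

variable {E L : Type*} [Field E] [Field L] [Algebra E L] [FiniteDimensional E L]
  [Algebra ℚ E] [Algebra ℚ L] [IsScalarTower ℚ E L]
  {σ : L ≃ₐ[E] L} {hσ : ∀ g, g ∈ Subgroup.zpowers σ} {z : Eˣ} {ω : L}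

theorem exists_algHom (hG : IsSplitMetacyclic a b r k) (hω : ω ^ p = 1) (hz : z ^ k = 1)
    (hσω : σ ω = ω ^ (r : ZMod p).val) (hd : orderOf σ = orderOf r) :
    ∃ ψ : MonoidAlgebra ℚ G →ₐ[ℚ] CyclicAlgebra σ hσ z,
      ψ (of ℚ G a) = ofField _ ω ∧ ψ (of ℚ G b) = CyclicAlgebra.gen hσ z := by
  have hx : ofField (FactorSet.cyclic σ hσ z) ω ^ p = 1 := by rw [← map_pow, hω, map_one]
  have hy : CyclicAlgebra.gen hσ z ^ (orderOf r * k) = 1 := by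
    rw [pow_mul, ← hd, CyclicAlgebra.gen_pow_orderOf, ← map_pow, ← map_pow,
      ← Units.val_pow_eq_pow_val, hz, Units.val_one, map_one, map_one]
  have hn0 : orderOf r * k ≠ 0 := (Nat.mul_pos hG.orderOf_pos_unit hG.pos).ne'
  obtain ⟨F, hFa, hFb⟩ := exists_monoidHom_of_isComplement'_zpowers hG.normal hG.isComplement
    (x := Units.ofPowEqOne _ p hx hG.neZero.ne) (y := Units.ofPowEqOne _ _ hy hn0)
    (hG.orderOf_left.symm ▸ orderOf_dvd_of_pow_eq_one (Units.pow_ofPowEqOne hx _))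
    (hG.orderOf_right.symm ▸ orderOf_dvd_of_pow_eq_one (Units.pow_ofPowEqOne hy _)) hG.conj (by
      rw [mul_inv_eq_iff_eq_mul, Units.ext_iff, Units.val_mul, Units.val_mul,
        Units.val_pow_eq_pow_val, Units.val_ofPowEqOne, Units.val_ofPowEqOne, ← map_pow, ← hσω]
      exact CyclicAlgebra.gen_mul_ofField ω)
  refine ⟨MonoidAlgebra.lift ℚ _ G ((Units.coeHom _).comp F), ?_, ?_⟩
  · rw [MonoidAlgebra.lift_of, MonoidHom.comp_apply, hFa, Units.coeHom_apply,
      Units.val_ofPowEqOne]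
  · rw [MonoidAlgebra.lift_of, MonoidHom.comp_apply, hFb, Units.coeHom_apply,
      Units.val_ofPowEqOne]

variable {ψ : MonoidAlgebra ℚ G →ₐ[ℚ] CyclicAlgebra σ hσ z}

theorem isComponentProjection (hG : IsSplitMetacyclic a b r k) {h : ℕ} (hk : h ∣ k)
    (hω : IsPrimitiveRoot ω p) (hz : IsPrimitiveRoot (algebraMap E L z) h)
    (hd : orderOf σ = orderOf r) (hL : Algebra.adjoin ℚ {ω * algebraMap E L z} = ⊤)
    (hψa : ψ (of ℚ G a) = ofField _ ω) (hψb : ψ (of ℚ G b) = CyclicAlgebra.gen hσ z) :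
    IsComponentProjection ψ (cyclicEps (a * b ^ orderOf r) (p * h)) := by
  have : CharZero L := algebraRat.charZero L
  have hw : IsPrimitiveRoot (ω * algebraMap E L z) (p * h) :=
    isPrimitiveRoot_mul_of_coprime hω hz (hG.coprime_right.coprime_dvd_right hk)
  have hph : p * h ∣ orderOf (a * b ^ orderOf r) := hG.orderOf_mul_pow ▸ mul_dvd_mul_left p hk
  have hph0 : 0 < p * h := Nat.pos_of_dvd_of_pos hph (orderOf_pos _)
  refine ⟨fun v => ?_, ?_, fun x hx => ?_⟩
  · obtain ⟨y, rfl⟩ := CyclicAlgebra.exists_eq_sum v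
    have hy (i : ℕ) : ∃ q : ℚ[X], aeval (ω * algebraMap E L z) q = y i := by
      have : y i ∈ Algebra.adjoin ℚ {ω * algebraMap E L z} := hL ▸ Algebra.mem_top
      rwa [Algebra.adjoin_singleton_eq_range_aeval] at this
    choose q hq using hy
    exact ⟨_, (CyclicAlgebra.map_sum_aeval hψa hψb q).trans (by simp only [hq])⟩
  · exact map_cyclicEps ψ (ofField _) hw (hd ▸ CyclicAlgebra.map_of_mul_pow hψa hψb) hph
  · obtain ⟨q, rfl⟩ := hG.exists_eq_sum x
    rw [← hd, CyclicAlgebra.map_sum_aeval hψa hψb] at hx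
    rw [Finset.sum_mul]
    refine Finset.sum_eq_zero fun i hi => ?_
    have hroot : aeval (ω * algebraMap E L z) (q i) = 0 := by
      rw [← CyclicAlgebra.coeff_pow_sum (hσ := hσ) (a := z)
        (fun i => aeval (ω * algebraMap E L z) (q i)) (hd ▸ Finset.mem_range.1 hi), hx, map_zero]
    obtain ⟨s, hs⟩ : cyclotomic (p * h) ℚ ∣ q i := by
      have hmin : cyclotomic (p * h) ℚ = minpoly ℚ (ω * algebraMap E L z) := by
        convert cyclotomic_eq_minpoly_rat hw hph0
        exact Subsingleton.elim _ _
      exact hmin ▸ minpoly.dvd _ _ hroot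
    rw [mul_assoc, Subalgebra.mem_center_iff.1 (hG.cyclicEps_mem_center _), ← mul_assoc, hs,
      mul_comm (cyclotomic _ _), map_mul, mul_assoc (aeval _ s),
      aeval_cyclotomic_mul_cyclicEps hph, mul_zero, zero_mul]

/-- An arbitrary generator `σ` acts on the `p`-th roots of unity as `b ^ j` acts on `⟨a⟩`, for some
`j` prime to the order of `b`; replacing `b` by `b ^ j` does not change the idempotent. -/
theorem exists_isComponentProjection [Fact p.Prime] (hG : IsSplitMetacyclic a b r k) {h : ℕ}
    (hk : h ∣ k) [IsCyclotomicExtension {p} E L] [IsCyclotomicExtension {p * h} ℚ L]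
    (hz : IsPrimitiveRoot z h) (hd : orderOf σ = orderOf r) :
    ∃ ψ : MonoidAlgebra ℚ G →ₐ[ℚ] CyclicAlgebra σ hσ z,
      IsComponentProjection ψ (cyclicEps (a * b ^ orderOf r) (p * h)) := by
  have hh : 0 < h := Nat.pos_of_dvd_of_pos hk hG.pos
  have : NeZero (p * h) := ⟨(Nat.mul_pos hG.neZero.pos hh).ne'⟩
  have hω := IsCyclotomicExtension.zeta_spec p E L
  set ω := IsCyclotomicExtension.zeta p E L
  have hzL : IsPrimitiveRoot (algebraMap E L z) h :=
    (IsPrimitiveRoot.coe_units_iff.2 hz).map_of_injective (algebraMap E L).injective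
  have hL : Algebra.adjoin ℚ {ω * algebraMap E L z} = ⊤ :=
    IsCyclotomicExtension.adjoin_primitive_root_eq_top
      (isPrimitiveRoot_mul_of_coprime hω hzL (hG.coprime_right.coprime_dvd_right hk))
  have horder : orderOf r = orderOf (hω.autToPow E σ) := by
    rw [orderOf_injective _ (hω.autToPow_injective E), hd]
  have : NeZero (orderOf r * k) := ⟨(Nat.mul_pos hG.orderOf_pos_unit hG.pos).ne'⟩
  obtain ⟨j, hj, hrj⟩ := exists_coprime_pow_eq (R := ZMod p) horder (dvd_mul_right _ k)
  have hσω : σ ω = ω ^ ((r ^ j : (ZMod p)ˣ) : ZMod p).val := by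
    rw [hrj, hω.autToPow_spec E]
  have hGj := hG.pow hj
  have hdj : orderOf σ = orderOf (r ^ j) := by
    rw [hd, hj.coprime_mul_right_right.symm.orderOf_pow]
  obtain ⟨ψ, hψa, hψb⟩ :=
    hGj.exists_algHom (hσ := hσ) hω.pow_eq_one ((hz.pow_eq_one_iff_dvd k).2 hk) hσω hdj
  exact ⟨ψ, hG.cyclicEps_pow hj h ▸ hGj.isComponentProjection hk hω hzL hdj hL hψa hψb⟩

end IsSplitMetacyclic

theorem existsUnique_subgroup_card_eq {Γ : Type*} [Group Γ] [Finite Γ] [IsCyclic Γ] {m : ℕ}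
    (hm : m ∣ Nat.card Γ) : ∃! H : Subgroup Γ, Nat.card H = m := by
  let _ : CommGroup Γ := IsCyclic.commGroup
  have hcard : Nat.card (powMonoidHom m : Γ →* Γ).ker = m := by
    rw [IsCyclic.card_powMonoidHom_ker, Nat.gcd_eq_right hm]
  refine ⟨(powMonoidHom m : Γ →* Γ).ker, hcard, fun H hH => ?_⟩
  refine Subgroup.eq_of_le_of_card_ge (fun x hx => ?_) (hcard.trans hH.symm).le
  rw [MonoidHom.mem_ker, powMonoidHom_apply, ← hH]
  exact congrArg Subtype.val (pow_card_eq_one' (x := (⟨x, hx⟩ : H)))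

section Galois

open IntermediateField Polynomial

variable {k K : Type*} [Field k] [Field K] [Algebra k K]

theorem existsUnique_intermediateField_finrank_eq [FiniteDimensional k K] [IsGalois k K]
    [IsCyclic Gal(K/k)] {m : ℕ} (hm : m ∣ Module.finrank k K) :
    ∃! F : IntermediateField k K, Module.finrank k F = m := by
  obtain ⟨c, hc⟩ := hm
  have hpos : 0 < m * c := hc ▸ Module.finrank_pos
  have hfix (F : IntermediateField k K) :
      Module.finrank k F = m ↔ Nat.card F.fixingSubgroup = c := by
    have hmul := Module.finrank_mul_finrank k F K
    rw [hc] at hmul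
    rw [IsGalois.card_fixingSubgroup_eq_finrank]
    constructor <;> intro h <;> rw [h] at hmul
    · exact Nat.eq_of_mul_eq_mul_left (Nat.pos_of_mul_pos_right hpos) hmul
    · exact Nat.eq_of_mul_eq_mul_right (Nat.pos_of_mul_pos_left hpos) hmul
  refine (IsGalois.intermediateFieldEquivSubgroup.toEquiv.existsUnique_congr fun {F} => hfix F).2
    (existsUnique_subgroup_card_eq ?_)
  rw [IsGalois.card_aut_eq_finrank, hc]
  exact dvd_mul_left c m

theorem existsUnique_le_finrank_eq (P : IntermediateField k K) [FiniteDimensional k P]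
    [IsGalois k P] [IsCyclic Gal(P/k)] {m : ℕ} (hm : m ∣ Module.finrank k P) :
    ∃! F : IntermediateField k K, F ≤ P ∧ Module.finrank k F = m := by
  obtain ⟨F, hF, huniq⟩ := existsUnique_intermediateField_finrank_eq hm
  refine ⟨lift F, ⟨lift_le F, ?_⟩, ?_⟩
  · rw [← hF]
    exact (liftAlgEquiv F).toLinearEquiv.finrank_eq.symm
  · rintro F' ⟨hle, hF'⟩
    rw [← huniq (restrict hle) ?_, lift_restrict]
    rw [← hF']
    exact (restrictAlgEquiv hle).toLinearEquiv.finrank_eq.symm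

theorem isCyclotomicExtension_adjoin_simple {x : K} {m : ℕ} [NeZero m] (hx : IsPrimitiveRoot x m) :
    IsCyclotomicExtension {m} k k⟮x⟯ :=
  (isCyclotomicExtension_singleton_iff_eq_adjoin m k K _ hx).2 rfl

theorem finrank_adjoin_simple {x : K} {m : ℕ} [NeZero m] (hx : IsPrimitiveRoot x m)
    (hirr : Irreducible (cyclotomic m k)) : Module.finrank k k⟮x⟯ = m.totient :=
  have := isCyclotomicExtension_adjoin_simple (k := k) hx
  IsCyclotomicExtension.finrank k⟮x⟯ hirr

theorem isCyclic_gal_of_isCyclotomicExtension_prime (p : ℕ) [Fact p.Prime]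
    [IsCyclotomicExtension {p} k K] : IsCyclic Gal(K/k) :=
  have hx := IsCyclotomicExtension.zeta_spec p k K
  isCyclic_of_injective _ (hx.autToPow_injective k)

theorem existsUnique_le_adjoin_finrank_eq {x : K} {p m : ℕ} [hp : Fact p.Prime]
    (hx : IsPrimitiveRoot x p) (hirr : Irreducible (cyclotomic p k)) (hm : m ∣ p - 1) :
    ∃! F : IntermediateField k K, F ≤ k⟮x⟯ ∧ Module.finrank k F = m := by
  have := isCyclotomicExtension_adjoin_simple (k := k) hx
  have := IsCyclotomicExtension.finiteDimensional {p} k k⟮x⟯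
  have := IsCyclotomicExtension.isGalois {p} k k⟮x⟯
  have : IsCyclic Gal(k⟮x⟯/k) := isCyclic_gal_of_isCyclotomicExtension_prime p
  refine existsUnique_le_finrank_eq _ ?_
  rwa [finrank_adjoin_simple hx hirr, Nat.totient_prime hp.out]

theorem adjoin_simple_le_of_pow_eq_one {x y : K} {m : ℕ} [NeZero m] (hx : IsPrimitiveRoot x m)
    (hy : y ^ m = 1) : k⟮y⟯ ≤ k⟮x⟯ := by
  obtain ⟨i, -, rfl⟩ := hx.eq_pow_of_pow_eq_one hy
  rw [adjoin_simple_le_iff]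
  exact pow_mem (mem_adjoin_simple_self k x) i

variable {m n : ℕ} [NeZero m] [NeZero n] {x y w : K}

theorem adjoin_simple_sup_adjoin_simple (hx : IsPrimitiveRoot x m) (hy : IsPrimitiveRoot y n)
    (hw : IsPrimitiveRoot w (m * n)) (h : m.Coprime n) : k⟮x⟯ ⊔ k⟮y⟯ = k⟮w⟯ := by
  refine le_antisymm (sup_le ?_ ?_) ?_
  · exact adjoin_simple_le_of_pow_eq_one hw (by rw [pow_mul, hx.pow_eq_one, one_pow])
  · exact adjoin_simple_le_of_pow_eq_one hw (by rw [mul_comm, pow_mul, hy.pow_eq_one, one_pow])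
  · refine (adjoin_simple_le_of_pow_eq_one (isPrimitiveRoot_mul_of_coprime hx hy h)
      hw.pow_eq_one).trans (adjoin_simple_le_iff.2 (mul_mem ?_ ?_))
    · exact (le_sup_left : k⟮x⟯ ≤ _) (mem_adjoin_simple_self k x)
    · exact (le_sup_right : k⟮y⟯ ≤ _) (mem_adjoin_simple_self k y)

theorem isCyclotomicExtension_extendScalars {E : IntermediateField k K} (hw : IsPrimitiveRoot w m)
    (hle : E ≤ k⟮w⟯) : IsCyclotomicExtension {m} k (extendScalars hle) :=
  isCyclotomicExtension_adjoin_simple hw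

theorem isCyclotomicExtension_extendScalars_sup {F : IntermediateField k K}
    (hx : IsPrimitiveRoot x m) (hy : IsPrimitiveRoot y n) (hw : IsPrimitiveRoot w (m * n))
    (h : m.Coprime n) (hF : F ≤ k⟮x⟯) (hle : F ⊔ k⟮y⟯ ≤ k⟮w⟯) :
    IsCyclotomicExtension {m} ↥(F ⊔ k⟮y⟯) (extendScalars hle) := by
  refine (isCyclotomicExtension_singleton_iff_eq_adjoin m _ K _ hx).2 ?_
  apply restrictScalars_injective k
  rw [extendScalars_restrictScalars, restrictScalars_adjoin_eq_sup, sup_right_comm,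
    sup_eq_right.2 hF, adjoin_simple_sup_adjoin_simple hx hy hw h]

theorem linearDisjoint_adjoin_simple (hx : IsPrimitiveRoot x m) (hy : IsPrimitiveRoot y n)
    (h : m.Coprime n) (hm : Irreducible (cyclotomic m k)) (hn : Irreducible (cyclotomic n k))
    (hmn : Irreducible (cyclotomic (m * n) k)) : k⟮x⟯.LinearDisjoint k⟮y⟯ := by
  have := isCyclotomicExtension_adjoin_simple (k := k) hx
  have := isCyclotomicExtension_adjoin_simple (k := k) hy
  have := IsCyclotomicExtension.finiteDimensional {m} k k⟮x⟯
  have := IsCyclotomicExtension.finiteDimensional {n} k k⟮y⟯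
  have hxy := isPrimitiveRoot_mul_of_coprime hx hy h
  apply LinearDisjoint.of_finrank_sup
  rw [adjoin_simple_sup_adjoin_simple hx hy hxy h, finrank_adjoin_simple hx hm,
    finrank_adjoin_simple hy hn, finrank_adjoin_simple hxy hmn, Nat.totient_mul h]

theorem finrank_mul_finrank_extendScalars_sup {F : IntermediateField k K}
    (hx : IsPrimitiveRoot x m) (hy : IsPrimitiveRoot y n) (hw : IsPrimitiveRoot w (m * n))
    (h : m.Coprime n) (hm : Irreducible (cyclotomic m k)) (hn : Irreducible (cyclotomic n k))
    (hmn : Irreducible (cyclotomic (m * n) k)) (hF : F ≤ k⟮x⟯) (hle : F ⊔ k⟮y⟯ ≤ k⟮w⟯) :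
    Module.finrank k F * Module.finrank ↥(F ⊔ k⟮y⟯) (extendScalars hle) = m.totient := by
  have hdisj := (linearDisjoint_adjoin_simple hx hy h hm hn hmn).of_le_left hF
  have htower := finrank_bot_mul_relfinrank hle
  rw [relfinrank_eq_finrank_of_le hle, finrank_adjoin_simple hw hmn, hdisj.finrank_sup,
    finrank_adjoin_simple hy hn, Nat.totient_mul h, mul_right_comm] at htower
  exact Nat.eq_of_mul_eq_mul_right (Nat.totient_pos.2 (NeZero.pos n)) htower

end Galois

namespace IsSplitMetacyclic

open IntermediateField

variable {G : Type*} [Group G] [Finite G] {a b : G} {p k : ℕ} [hp : Fact p.Prime] {r : (ZMod p)ˣ}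

theorem exists_isComponentProjection_extendScalars (hG : IsSplitMetacyclic a b r k) {h : ℕ}
    (hk : h ∣ k) {K : Type*} [Field K] [CharZero K] {x y w : K} (hx : IsPrimitiveRoot x p)
    (hy : IsPrimitiveRoot y h) (hw : IsPrimitiveRoot w (p * h)) {F : IntermediateField ℚ K}
    (hF : F ≤ ℚ⟮x⟯) (hrank : Module.finrank ℚ F * orderOf r = p - 1) :
    ∃ hle : F ⊔ ℚ⟮y⟯ ≤ ℚ⟮w⟯, ∃ _ : FiniteDimensional ↥(F ⊔ ℚ⟮y⟯) (extendScalars hle),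
      ∃ z : (↥(F ⊔ ℚ⟮y⟯))ˣ, ((z : ↥(F ⊔ ℚ⟮y⟯)) : K) = y ∧
        IsGalois ↥(F ⊔ ℚ⟮y⟯) (extendScalars hle) ∧
        IsCyclic Gal(extendScalars hle/↥(F ⊔ ℚ⟮y⟯)) ∧
        ∀ (σ : Gal(extendScalars hle/↥(F ⊔ ℚ⟮y⟯))) (hσ : ∀ g, g ∈ Subgroup.zpowers σ),
          orderOf σ = orderOf r ∧ ∃ ψ : MonoidAlgebra ℚ G →ₐ[ℚ] CyclicAlgebra σ hσ z,
            IsComponentProjection ψ (cyclicEps (a * b ^ orderOf r) (p * h)) := by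
  have : NeZero h := ⟨(Nat.pos_of_dvd_of_pos hk hG.pos).ne'⟩
  have hcop : p.Coprime h := hG.coprime_right.coprime_dvd_right hk
  have hsup := adjoin_simple_sup_adjoin_simple (k := ℚ) hx hy hw hcop
  have hle : F ⊔ ℚ⟮y⟯ ≤ ℚ⟮w⟯ := (sup_le_sup_right hF _).trans_eq hsup
  have hirr {m : ℕ} [NeZero m] := Polynomial.cyclotomic.irreducible_rat (NeZero.pos m)
  have hdeg := finrank_mul_finrank_extendScalars_sup hx hy hw hcop hirr hirr hirr hF hle
  rw [Nat.totient_prime hp.out, ← hrank] at hdeg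
  have : IsCyclotomicExtension {p} ↥(F ⊔ ℚ⟮y⟯) (extendScalars hle) :=
    isCyclotomicExtension_extendScalars_sup hx hy hw hcop hF hle
  have : IsCyclotomicExtension {p * h} ℚ (extendScalars hle) :=
    isCyclotomicExtension_extendScalars hw hle
  have hfin := IsCyclotomicExtension.finiteDimensional {p} ↥(F ⊔ ℚ⟮y⟯) (extendScalars hle)
  have hgal := IsCyclotomicExtension.isGalois {p} ↥(F ⊔ ℚ⟮y⟯) (extendScalars hle)
  have hy' : IsPrimitiveRoot (⟨y, (le_sup_right : ℚ⟮y⟯ ≤ F ⊔ ℚ⟮y⟯) (mem_adjoin_simple_self ℚ y)⟩ :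
      ↥(F ⊔ ℚ⟮y⟯)) h := IsPrimitiveRoot.coe_submonoidClass_iff.1 hy
  refine ⟨hle, hfin, (hy'.isUnit (NeZero.ne h)).unit, rfl, hgal,
    isCyclic_gal_of_isCyclotomicExtension_prime p, fun σ hσ => ?_⟩
  have hd : orderOf σ = orderOf r := by
    rw [orderOf_eq_card_of_forall_mem_zpowers hσ, IsGalois.card_aut_eq_finrank]
    refine Nat.eq_of_mul_eq_mul_left (Nat.pos_of_mul_pos_right (b := orderOf r) ?_) hdeg
    exact hrank ▸ Nat.sub_pos_of_lt hp.out.one_lt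
  exact ⟨hd, hG.exists_isComponentProjection hk (IsPrimitiveRoot.coe_units_iff.1 hy') hd⟩

theorem isSimpleComponent_and_exists_mul_ne_mul (hG : IsSplitMetacyclic a b r k) {h : ℕ}
    (hk : h ∣ k) (hr : orderOf r ≠ 1) :
    IsSimpleComponent (componentOf (cyclicEps (a * b ^ orderOf r) (p * h))) ∧
      ∃ x ∈ componentOf (cyclicEps (a * b ^ orderOf r) (p * h)),
        ∃ y ∈ componentOf (cyclicEps (a * b ^ orderOf r) (p * h)), x * y ≠ y * x := by
  have hh : h ≠ 0 := (Nat.pos_of_dvd_of_pos hk hG.pos).ne'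
  obtain ⟨d, hd⟩ := ZMod.orderOf_units_dvd_card_sub_one r
  have hx := Complex.isPrimitiveRoot_exp p hp.out.ne_zero
  obtain ⟨F, ⟨hF, hrank⟩, -⟩ := existsUnique_le_adjoin_finrank_eq (k := ℚ) hx
    (Polynomial.cyclotomic.irreducible_rat hp.out.pos) (hd ▸ dvd_mul_left d _)
  obtain ⟨hle, _, z, -, _, ⟨σ, hσ⟩, hψ⟩ := hG.exists_isComponentProjection_extendScalars hk hx
    (Complex.isPrimitiveRoot_exp h hh)
    (Complex.isPrimitiveRoot_exp (p * h) (mul_ne_zero hp.out.ne_zero hh)) hF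
    (by rw [hrank, hd, mul_comm])
  obtain ⟨hσr, ψ, hψ⟩ := hψ σ hσ
  have hσ1 : σ ≠ 1 := fun h1 => hr (hσr ▸ orderOf_eq_one_iff.2 h1)
  exact ⟨hψ.isSimpleComponent (hG.cyclicEps_mem_center _),
    hψ.exists_mul_ne_mul (CrossedProduct.exists_mul_ne_mul hσ1)⟩

theorem isSimpleComponent_and_not_commutative_iff (hG : IsSplitMetacyclic a b r k)
    (hr : orderOf r ≠ 1) {B : NonUnitalSubalgebra ℚ (MonoidAlgebra ℚ G)} :
    (IsSimpleComponent B ∧ ∃ x ∈ B, ∃ y ∈ B, x * y ≠ y * x) ↔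
      ∃ h, h ∣ k ∧ B = compB a b (orderOf r * k) k h := by
  have hcomp (i : {h // h ∣ k}) := hG.isSimpleComponent_and_exists_mul_ne_mul i.2 hr
  simp only [hG.compB_eq]
  rw [_root_.isSimpleComponent_and_not_commutative_iff (fun i => (hcomp i).1)
    (fun i => (hcomp i).2) fun x hx => hG.mem_center_of_forall_mul_cyclicEps_eq_zero
      fun h hh => hx ⟨h, hh⟩, Subtype.exists]
  simp only [exists_prop]

end IsSplitMetacyclic

theorem lemma3p1_general
    {G : Type*} [Group G] [Finite G] {p n k : ℕ} (hp : p.Prime) (hpn : ¬ p ∣ n)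
    {a b : G} (ha : orderOf a = p) (hb : orderOf b = n)
    (hnormal : (Subgroup.zpowers a).Normal)
    (hcompl : Subgroup.IsComplement' (Subgroup.zpowers a) (Subgroup.zpowers b))
    (hk : Nat.card (Subgroup.zpowers b ⊓ Subgroup.centralizer {a} : Subgroup G) = k)
    {K : Type*} [Field K] [CharZero K] {ζ : ℕ → K}
    (hζ : ∀ m, m ∣ p * k → IsPrimitiveRoot (ζ m) m) :
    (∃! F : IntermediateField ℚ K, F ≤ ℚ⟮ζ p⟯ ∧ Module.finrank ℚ F = (p - 1) * k / n) ∧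
    (k ≠ n → ∀ B : NonUnitalSubalgebra ℚ (MonoidAlgebra ℚ G),
      (IsSimpleComponent B ∧ ∃ x ∈ B, ∃ y ∈ B, x * y ≠ y * x) ↔
        ∃ h, h ∣ k ∧ B = compB a b n k h) ∧
    ∀ F : IntermediateField ℚ K, F ≤ ℚ⟮ζ p⟯ → Module.finrank ℚ F = (p - 1) * k / n →
      ∀ h, h ∣ k →
        ∃ hle : F ⊔ ℚ⟮ζ h⟯ ≤ ℚ⟮ζ (p * h)⟯,
        ∃ _ : FiniteDimensional ↥(F ⊔ ℚ⟮ζ h⟯) ↥(IntermediateField.extendScalars hle),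
        ∃ z : (↥(F ⊔ ℚ⟮ζ h⟯))ˣ, ((z : ↥(F ⊔ ℚ⟮ζ h⟯)) : K) = ζ h ∧
          IsGalois ↥(F ⊔ ℚ⟮ζ h⟯) ↥(IntermediateField.extendScalars hle) ∧
          IsCyclic (↥(IntermediateField.extendScalars hle) ≃ₐ[↥(F ⊔ ℚ⟮ζ h⟯)]
            ↥(IntermediateField.extendScalars hle)) ∧
          ∀ (σ : ↥(IntermediateField.extendScalars hle) ≃ₐ[↥(F ⊔ ℚ⟮ζ h⟯)]
              ↥(IntermediateField.extendScalars hle))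
            (hσ : ∀ g, g ∈ Subgroup.zpowers σ),
            ∃ φ : compB a b n k h ≃ₗ[ℚ] CyclicAlgebra σ hσ z,
              ∀ x y, φ (x * y) = φ x * φ y := by
  have := Fact.mk hp
  obtain ⟨r, rfl, hG⟩ := exists_isSplitMetacyclic hp hpn ha hb hnormal hcompl hk
  obtain ⟨d, hd⟩ := ZMod.orderOf_units_dvd_card_sub_one r
  have hdeg : (p - 1) * k / (orderOf r * k) = d := by
    rw [Nat.mul_div_mul_right _ _ hG.pos, hd, Nat.mul_div_cancel_left _ hG.orderOf_pos_unit]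
  have hζp := hζ p (dvd_mul_right p k)
  rw [hdeg]
  refine ⟨existsUnique_le_adjoin_finrank_eq hζp (Polynomial.cyclotomic.irreducible_rat hp.pos)
    (hd ▸ dvd_mul_left d _), fun hkn B => ?_, fun F hF hrank h hh => ?_⟩
  · exact hG.isSimpleComponent_and_not_commutative_iff fun hr => hkn (by rw [hr, one_mul])
  · obtain ⟨hle, hfin, z, hz, hgal, hcyc, hψ⟩ := hG.exists_isComponentProjection_extendScalars hh
      hζp (hζ h (hh.mul_left p)) (hζ (p * h) (mul_dvd_mul_left p hh)) hF
      (by rw [hrank, hd, mul_comm])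
    refine ⟨hle, hfin, z, hz, hgal, hcyc, fun σ hσ => ?_⟩
    obtain ⟨-, ψ, hψ⟩ := hψ σ hσ
    exact hG.compB_eq h ▸ hψ.exists_linearEquiv

theorem lemma3p1
    {G : Type*} [Group G] [Finite G] (p n k : ℕ) (hp : p.Prime) (hpn : ¬ p ∣ n)
    -- `G = ⟨a⟩_p ⋊_k ⟨b⟩_n`
    (a b : G) (ha : orderOf a = p) (hb : orderOf b = n)
    (hnormal : (Subgroup.zpowers a).Normal)
    (hcompl : Subgroup.IsComplement' (Subgroup.zpowers a) (Subgroup.zpowers b))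
    (hk : Nat.card (Subgroup.zpowers b ⊓ Subgroup.centralizer {a} : Subgroup G) = k)
    -- `ζ m` is a complex primitive `m`-th root of unity
    (ζ : ℕ → ℂ) (hζ : ∀ m, 0 < m → IsPrimitiveRoot (ζ m) m) :
    (∃! F : IntermediateField ℚ ℂ, F ≤ ℚ⟮ζ p⟯ ∧ Module.finrank ℚ F = (p - 1) * k / n) ∧
    (k ≠ n → ∀ B : NonUnitalSubalgebra ℚ (MonoidAlgebra ℚ G),
      (IsSimpleComponent B ∧ ∃ x ∈ B, ∃ y ∈ B, x * y ≠ y * x) ↔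
        ∃ h, h ∣ k ∧ B = compB a b n k h) ∧
    ∀ F : IntermediateField ℚ ℂ, F ≤ ℚ⟮ζ p⟯ → Module.finrank ℚ F = (p - 1) * k / n →
      ∀ h, h ∣ k →
        -- with `E = F(ζ_h)` and `L = ℚ(ζ_{ph})`, the extension `L/E` is finite cyclic
        ∃ hle : F ⊔ ℚ⟮ζ h⟯ ≤ ℚ⟮ζ (p * h)⟯,
        ∃ _ : FiniteDimensional ↥(F ⊔ ℚ⟮ζ h⟯) ↥(IntermediateField.extendScalars hle),
        ∃ z : (↥(F ⊔ ℚ⟮ζ h⟯))ˣ, ((z : ↥(F ⊔ ℚ⟮ζ h⟯)) : ℂ) = ζ h ∧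
          IsGalois ↥(F ⊔ ℚ⟮ζ h⟯) ↥(IntermediateField.extendScalars hle) ∧
          IsCyclic (↥(IntermediateField.extendScalars hle) ≃ₐ[↥(F ⊔ ℚ⟮ζ h⟯)]
            ↥(IntermediateField.extendScalars hle)) ∧
          -- and `B_h ≅ (L/E, ζ_h)`, whatever generator of `Gal(L/E)` is used
          ∀ (σ : ↥(IntermediateField.extendScalars hle) ≃ₐ[↥(F ⊔ ℚ⟮ζ h⟯)]
              ↥(IntermediateField.extendScalars hle))
            (hσ : ∀ g, g ∈ Subgroup.zpowers σ),
            ∃ φ : compB a b n k h ≃ₗ[ℚ] CyclicAlgebra σ hσ z,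
              ∀ x y, φ (x * y) = φ x * φ y := by
  have hk0 : 0 < k := hk ▸ Nat.card_pos
  exact lemma3p1_general hp hpn ha hb hnormal hcompl hk
    fun m hm => hζ m (Nat.pos_of_dvd_of_pos hm (Nat.mul_pos hp.pos hk0))
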